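/- **Setting.** Let $\Omega$ be a nonempty bounded open subset of $\mathbb{R}^N$ with Lipschitz boundary, let $m\ge 2$, let $I=\{1,\dots,m\}$, and let $(\Omega_i)_{i\in I}$ be pairwise disjoint open subsets of $\Omega$ with Lipschitz boundaries such that $\overline\Omega=\bigcup_{i\in I}\overline{\Omega_i}$. For $i\in I$, let $\Upsilon_{ii}$ be the interior of $\partial\Omega_i\cap\partial\Omega$ relative to $\partial\Omega$; for $i<j$, let $\Upsilon_{ij}=\Upsilon_{ji}$ be the interior of $\partial\Omega_i\cap\partial\Omega_j$ relative to $\partial\Omega_i$; let $J(i)=\{j\in I\setminus\{i\}\mid \Upsilon_{ij}\ne\varnothing\}$. Suppose that $\Upsilon_{ii}\neq\varnothing$ and $J(i)\ne\varnothing$ for every $i\in I$. Let $\mathsf T_i\colon H^1(\Omega_i)\to L^2(\partial\Omega_i)$ be the trace operator, i.e., the unique bounded linear operator such that $\mathsf T_iv=v|_{\partial\Omega_i}$ for every $v\in C^1(\overline{\Omega_i})$, and let $$\mathcal H_i=\{u\in H^1(\Omega_i)\mid \mathsf T_iu=0\text{ a.e. on }\Upsilon_{ii}\},\qquad \langle u\mid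 v\rangle=\int_{\Omega_i}Du\cdot Dv,\qquad \|u\|^2=\langle u\mid u\rangle .$$ Suppose that, for every $i\in I$, $\langle\cdot\mid\cdot\rangle$ is a scalar product on $\mathcal H_i$, that is, $\|u\|=0$ only for $u=0$ (this is the case, for instance, if every $\Omega_i$ is connected). For $f\in L^2(\Omega_i)$ and $(h_j)_{j\in J(i)}\in\bigoplus_{j\in J(i)}L^2(\Upsilon_{ij})$, $Q_i(f,(h_j)_{j\in J(i)})$ denotes the weak solution of $-\Delta u=f$ on $\Omega_i$, $u=0$ on $\Upsilon_{ii}$, $\partial_{\nu_i}u=h_j$ on $\Upsilon_{ij}$ for $j\in J(i)$, $j>i$, and $\partial_{\nu_i}u=-h_j$ on $\Upsilon_{ij}$ for $j\in J(i)$, $j<i$; that is, the $u\in\mathcal H_i$ such that, for every $v\in\mathcal H_i$, $$\int_{\Omega_i}Du\cdot Dv=\int_{\Omega_i}fv+\sum_{j\in J(i),\,j>i}\int_{\Upsilon_{ij}}h_j\,\mathsf T_iv\,dS-\sum_{j\in J(i),\,j<i}\int_{\Upsilon_{ij}}h_j\,\mathsf T_iv\,dS .$$ For a real Hilbert space $\mathcal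 H$ and $\varphi\colon\mathcal H\to\left]-\infty,+\infty\right]$, put $\partial\varphi(u)=\{w\mid\varphi(u)+\langle v-u\mid w\rangle\le\varphi(v)\ \forall v\in\mathcal H\}$ and let $\operatorname{prox}_\varphi u$ be the unique minimizer of $v\mapsto\varphi(v)+\frac12\|u-v\|^2$ (when there is one). For a nonempty closed convex set $C\subset\mathcal H$, $\iota_C$ is $0$ on $C$ and $+\infty$ elsewhere, $P_C$ is the projection onto $C$, and $N_C(u)=\{w\mid\langle v-u\mid w\rangle\le0\ \forall v\in C\}$ if $u\in C$, $N_C(u)=\varnothing$ otherwise. **Statement.** Let $\gamma\in\left]0,+\infty\right[$, let $f\in L^2(\Omega)$, for every $i\in I$ let $C_i$ be a nonempty closed convex subset of $\mathcal H_i$, and let $$\varphi_i\colon\mathcal H_i\to\left]-\infty,+\infty\right]\colon u\mapsto\iota_{C_i}(u)+\frac12\int_{\Omega_i}|Du|^2-\int_{\Omega_i}fu .$$ Then, for every $i\in I$, $\mathcal H_i$ is a Hilbert space, $q_i=Q_i(f|_{\Omega_i},0,\dots,0)$ is well defined (the weak solution exists and is unique), and the following hold. (i) For every $u\in\mathcal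 H_i$, $$\varphi_i(u)=\iota_{C_i}(u)+\tfrac12\|u\|^2-\langle q_i\mid u\rangle,\qquad \partial\varphi_i(u)=N_{C_i}(u)+u-q_i,\qquad \operatorname{prox}_{\gamma\varphi_i}u=P_{C_i}\Big(\frac1{1+\gamma}u+\frac{\gamma}{1+\gamma}q_i\Big),$$ where both sides of the last equality are well defined. (ii) If $C_i=\mathcal H_i$, then $\varphi_i$ is real-valued and Gâteaux differentiable on $\mathcal H_i$ and, for every $u\in\mathcal H_i$, $$\varphi_i(u)=\tfrac12\|u\|^2-\langle q_i\mid u\rangle,\qquad \nabla\varphi_i(u)=u-q_i,\qquad \operatorname{prox}_{\gamma\varphi_i}u=\frac1{1+\gamma}u+\frac{\gamma}{1+\gamma}q_i .$$ -/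

import Mathlib

open MeasureTheory Set Filter Topology
open scoped ContDiff Pointwise

noncomputable section

namespace DomDec

/-! ## Convex analysis in a real (semi-)inner product space -/

section Convex

/-- The indicator function `ι_C`: zero on `C` and `+∞` elsewhere. -/
def indic {H : Type*} (C : Set H) (u : H) : EReal :=
  open Classical in if u ∈ C then 0 else ⊤

/-- The subdifferential `∂φ`. -/
def subdifferential {H : Type*} [SeminormedAddCommGroup H] [InnerProductSpace ℝ H]
    (φ : H → EReal) (u : H) : Set H :=
  {w | ∀ v : H, φ u + ((inner ℝ (v - u) w : ℝ) : EReal) ≤ φ v}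

/-- The normal cone operator `N_C`; it is empty-valued outside `C`. -/
def normalCone {H : Type*} [SeminormedAddCommGroup H] [InnerProductSpace ℝ H]
    (C : Set H) (u : H) : Set H :=
  {w | u ∈ C ∧ ∀ v ∈ C, inner ℝ (v - u) w ≤ 0}

/-- The set of minimizers of `v ↦ φ(v) + ½‖u - v‖²`; thus `prox_φ u = p` means that this set
is `{p}`. -/
def proxSet {H : Type*} [SeminormedAddCommGroup H] (φ : H → EReal) (u : H) : Set H :=
  {p | ∀ v : H, φ p + ((1 / 2 * ‖u - p‖ ^ 2 : ℝ) : EReal)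
    ≤ φ v + ((1 / 2 * ‖u - v‖ ^ 2 : ℝ) : EReal)}

/-- The set of best approximations to `u` from `C`; thus `P_C u = p` means that this set
is `{p}`. -/
def projSet {H : Type*} [SeminormedAddCommGroup H] (C : Set H) (u : H) : Set H :=
  {p | p ∈ C ∧ ∀ v ∈ C, ‖u - p‖ ≤ ‖u - v‖}

/-- `w` is the Gâteaux gradient of the real-valued function `g` at `u`: for every direction `y`,
`(g (u + t y) - g u) / t → ⟨w, y⟩` as `t → 0`. -/
def HasGateauxGradientAt {H : Type*} [SeminormedAddCommGroup H] [InnerProductSpace ℝ H]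
    (g : H → ℝ) (w u : H) : Prop :=
  ∀ y : H, HasLineDerivAt ℝ g (inner ℝ w y) u y

end Convex

/-! ## Lipschitz domains, Sobolev spaces, traces -/

/-- `ℝ^N` with its Euclidean norm. -/
abbrev Eu (N : ℕ) : Type := EuclideanSpace ℝ (Fin N)

/-- `Ω` has a Lipschitz boundary: near each of its boundary points, `Ω` is the set of points that
lie above the graph of a Lipschitz function, in some direction `e`. A function of the coordinates
orthogonal to `e` is written as a function on the whole space that is invariant along `e`. -/
def HasLipschitzBoundary {N : ℕ} (Ω : Set (Eu N)) : Prop :=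
  ∀ x₀ ∈ frontier Ω, ∃ (e : Eu N) (g : Eu N → ℝ),
    ‖e‖ = 1 ∧ (∃ K, LipschitzWith K g) ∧ (∀ (x : Eu N) (t : ℝ), g (x + t • e) = g x) ∧
    ∀ᶠ x in 𝓝 x₀, (x ∈ Ω ↔ g x < inner ℝ e x)

/-- The interior of `A` relative to `B`, for `A ⊆ B`. -/
def relInterior {X : Type*} [TopologicalSpace X] (B A : Set X) : Set X :=
  {x | x ∈ B ∧ A ∈ 𝓝[B] x}

/-- `L²(Ω)`, for the Lebesgue measure. -/
abbrev L2 {N : ℕ} (Ω : Set (Eu N)) : Type := Lp ℝ 2 (volume.restrict Ω)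

/-- Square-integrable vector fields on `Ω`. -/
abbrev L2Vec {N : ℕ} (Ω : Set (Eu N)) : Type := Lp (Eu N) 2 (volume.restrict Ω)

/-- `L²(Υ)` for a piece `Υ` of a boundary; the surface measure is the `(N-1)`-dimensional
Hausdorff measure, normalized so as to be Lebesgue measure on hyperplanes. -/
abbrev L2Surf {N : ℕ} (Y : Set (Eu N)) : Type :=
  Lp ℝ 2 ((μHE[N - 1] : Measure (Eu N)).restrict Y)

/-- `g` is the weak gradient of `u` on `Ω`. -/
def IsWeakGradient {N : ℕ} (Ω : Set (Eu N)) (u : Eu N → ℝ) (g : Eu N → Eu N) : Prop :=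
  ∀ θ : Eu N → ℝ, ContDiff ℝ ∞ θ → HasCompactSupport θ → tsupport θ ⊆ Ω → ∀ y : Eu N,
    ∫ x in Ω, u x * fderiv ℝ θ x y = - ∫ x in Ω, θ x * inner ℝ (g x) y

lemma integrable_mul_test {N : ℕ} {Ω : Set (Eu N)} (u : L2 Ω) {θ : Eu N → ℝ}
    (hθ : Continuous θ) (hc : HasCompactSupport θ) :
    Integrable (fun x => u x * θ x) (volume.restrict Ω) :=
  (Lp.memLp u).integrable_mul
    (((hθ.memLp_of_hasCompactSupport (p := 2) (μ := volume) hc)).restrict Ω)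

lemma integrable_mul_fderiv {N : ℕ} {Ω : Set (Eu N)} (u : L2 Ω) {θ : Eu N → ℝ}
    (hθ : ContDiff ℝ ∞ θ) (hc : HasCompactSupport θ) (y : Eu N) :
    Integrable (fun x => u x * fderiv ℝ θ x y) (volume.restrict Ω) :=
  integrable_mul_test u ((hθ.continuous_fderiv (by simp)).clm_apply continuous_const)
    (hc.fderiv_apply ℝ y)

lemma integrable_mul_inner {N : ℕ} {Ω : Set (Eu N)} (g : L2Vec Ω) {θ : Eu N → ℝ}
    (hθ : Continuous θ) (hc : HasCompactSupport θ) (y : Eu N) :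
    Integrable (fun x => θ x * inner ℝ (g x) y) (volume.restrict Ω) :=
  ((hθ.memLp_of_hasCompactSupport (p := 2) (μ := volume) hc).restrict Ω).integrable_mul
    ((Lp.memLp g).inner_const y)

/-- `H¹(Ω)`, realized as the space of the pairs `(u, Du)` of a function in `L²(Ω)` and its weak
gradient in `L²(Ω)^N`, with the scalar product `∫ u v + ∫ Du · Dv`. -/
def H1 {N : ℕ} (Ω : Set (Eu N)) : Submodule ℝ (WithLp 2 (L2 Ω × L2Vec Ω)) where
  carrier := {p | IsWeakGradient Ω p.fst p.snd}
  zero_mem' := by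
    intro θ _ _ _ y
    have h1 : ∀ᵐ x ∂(volume.restrict Ω),
        ((0 : WithLp 2 (L2 Ω × L2Vec Ω)).fst : Eu N → ℝ) x * fderiv ℝ θ x y = 0 := by
      filter_upwards [Lp.coeFn_zero ℝ 2 (volume.restrict Ω)] with x hx
      rw [WithLp.zero_fst, hx, Pi.zero_apply, zero_mul]
    have h2 : ∀ᵐ x ∂(volume.restrict Ω),
        θ x * inner ℝ (((0 : WithLp 2 (L2 Ω × L2Vec Ω)).snd : Eu N → Eu N) x) y = 0 := by
      filter_upwards [Lp.coeFn_zero (Eu N) 2 (volume.restrict Ω)] with x hx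
      rw [WithLp.zero_snd, hx, Pi.zero_apply, inner_zero_left, mul_zero]
    rw [integral_eq_zero_of_ae h1, integral_eq_zero_of_ae h2, neg_zero]
  add_mem' := by
    intro p q hp hq θ h1 h2 h3 y
    have e1 : ∫ x in Ω, ((p + q).fst : Eu N → ℝ) x * fderiv ℝ θ x y
        = ∫ x in Ω, (p.fst x * fderiv ℝ θ x y + q.fst x * fderiv ℝ θ x y) := by
      apply integral_congr_ae
      filter_upwards [Lp.coeFn_add p.fst q.fst] with x hx
      rw [WithLp.add_fst, hx, Pi.add_apply, add_mul]
    have e2 : ∫ x in Ω, θ x * inner ℝ (((p + q).snd : Eu N → Eu N) x) y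
        = ∫ x in Ω, (θ x * inner ℝ (p.snd x) y + θ x * inner ℝ (q.snd x) y) := by
      apply integral_congr_ae
      filter_upwards [Lp.coeFn_add p.snd q.snd] with x hx
      rw [WithLp.add_snd, hx, Pi.add_apply, inner_add_left, mul_add]
    rw [e1, e2, integral_add (integrable_mul_fderiv _ h1 h2 y) (integrable_mul_fderiv _ h1 h2 y),
      integral_add (integrable_mul_inner _ h1.continuous h2 y)
        (integrable_mul_inner _ h1.continuous h2 y), hp θ h1 h2 h3 y, hq θ h1 h2 h3 y]
    ring
  smul_mem' := by
    intro c p hp θ h1 h2 h3 y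
    have e1 : ∫ x in Ω, ((c • p).fst : Eu N → ℝ) x * fderiv ℝ θ x y
        = ∫ x in Ω, c * (p.fst x * fderiv ℝ θ x y) := by
      apply integral_congr_ae
      filter_upwards [Lp.coeFn_smul c p.fst] with x hx
      rw [WithLp.smul_fst, hx, Pi.smul_apply, smul_eq_mul, mul_assoc]
    have e2 : ∫ x in Ω, θ x * inner ℝ (((c • p).snd : Eu N → Eu N) x) y
        = ∫ x in Ω, c * (θ x * inner ℝ (p.snd x) y) := by
      apply integral_congr_ae
      filter_upwards [Lp.coeFn_smul c p.snd] with x hx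
      rw [WithLp.smul_snd, hx, Pi.smul_apply, real_inner_smul_left]
      ring
    rw [e1, e2, integral_const_mul, integral_const_mul, hp θ h1 h2 h3 y]
    ring

/-- `v ∈ C¹(closure Ω)`: `v` is continuously differentiable on `Ω`, and `v` and its gradient `G`
are continuous up to the boundary. -/
def IsC1UpToBoundary {N : ℕ} (Ω : Set (Eu N)) (v : Eu N → ℝ) : Prop :=
  ∃ G : Eu N → Eu N, ContinuousOn v (closure Ω) ∧ ContinuousOn G (closure Ω) ∧
    ∀ x ∈ Ω, HasGradientAt v (G x) x

/-- `T` is the Sobolev trace operator of `Ω`: it is a bounded linear operator from `H¹(Ω)` to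
`L²(bdry Ω)` which maps every `v ∈ C¹(closure Ω)` to its restriction to `bdry Ω`. -/
def IsTraceOperator {N : ℕ} (Ω : Set (Eu N)) (T : H1 Ω →L[ℝ] L2Surf (frontier Ω)) : Prop :=
  ∀ (u : H1 Ω) (v : Eu N → ℝ), IsC1UpToBoundary Ω v →
    (u.1.fst : Eu N → ℝ) =ᵐ[volume.restrict Ω] v →
    (T u : Eu N → ℝ) =ᵐ[(μHE[N - 1] : Measure (Eu N)).restrict (frontier Ω)] v

/-- The Sobolev trace operator. On a bounded open set with Lipschitz boundary there is exactly one
operator as in `IsTraceOperator`; on sets where there is none, the value is irrelevant. -/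
def traceOp {N : ℕ} (Ω : Set (Eu N)) : H1 Ω →L[ℝ] L2Surf (frontier Ω) :=
  Classical.epsilon (IsTraceOperator Ω)

/-- `H¹_{0,Υ}(Ω)`: the functions in `H¹(Ω)` whose trace vanishes on `Υ`. -/
def H1Zero {N : ℕ} (Ω Y : Set (Eu N)) : Submodule ℝ (H1 Ω) where
  carrier := {u | ∀ᵐ x ∂(μHE[N - 1] : Measure (Eu N)).restrict (frontier Ω),
    x ∈ Y → traceOp Ω u x = 0}
  zero_mem' := by
    have := Lp.coeFn_zero ℝ 2 ((μHE[N - 1] : Measure (Eu N)).restrict (frontier Ω))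
    simp only [mem_ofPred_eq, map_zero]
    filter_upwards [this] with x hx _
    rw [hx, Pi.zero_apply]
  add_mem' := by
    intro u v hu hv
    simp only [mem_ofPred_eq, map_add] at hu hv ⊢
    filter_upwards [Lp.coeFn_add (traceOp Ω u) (traceOp Ω v), hu, hv] with x hx h1 h2 hY
    rw [hx, Pi.add_apply, h1 hY, h2 hY, add_zero]
  smul_mem' := by
    intro c u hu
    simp only [mem_ofPred_eq, map_smul] at hu ⊢
    filter_upwards [Lp.coeFn_smul c (traceOp Ω u), hu] with x hx h1 hY
    rw [hx, Pi.smul_apply, h1 hY, smul_zero]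

/-- The vector space `H¹_{0,Υ}(Ω)`, to be endowed with the scalar product `∫ Du · Dv`
(and not with that of `H¹(Ω)`). -/
def H1ZeroSpace {N : ℕ} (Ω Y : Set (Eu N)) : Type := ↥(H1Zero Ω Y)

namespace H1ZeroSpace

variable {N : ℕ} {Ω Y : Set (Eu N)}

instance : AddCommGroup (H1ZeroSpace Ω Y) := inferInstanceAs (AddCommGroup ↥(H1Zero Ω Y))

instance : Module ℝ (H1ZeroSpace Ω Y) := inferInstanceAs (Module ℝ ↥(H1Zero Ω Y))

/-- The element of `H¹(Ω)` underlying an element of `H¹_{0,Υ}(Ω)`. -/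
def toH1 (u : H1ZeroSpace Ω Y) : H1 Ω := u.1

/-- The function in `L²(Ω)` underlying an element of `H¹_{0,Υ}(Ω)`. -/
def fn (u : H1ZeroSpace Ω Y) : L2 Ω := u.toH1.1.fst

/-- The weak gradient. -/
def grad : H1ZeroSpace Ω Y →ₗ[ℝ] L2Vec Ω where
  toFun u := u.toH1.1.snd
  map_add' _ _ := rfl
  map_smul' _ _ := rfl

/-- The (semi)norm `‖u‖ = ‖Du‖_{L²}`, that is, `‖u‖² = ∫ |Du|²`. -/
instance : SeminormedAddCommGroup (H1ZeroSpace Ω Y) :=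
  SeminormedAddCommGroup.induced (H1ZeroSpace Ω Y) (L2Vec Ω) grad

/-- The scalar product `⟨u, v⟩ = ∫ Du · Dv`. -/
instance : InnerProductSpace ℝ (H1ZeroSpace Ω Y) where
  norm_smul_le c u := by
    change ‖grad (c • u)‖ ≤ ‖c‖ * ‖grad u‖
    rw [map_smul, norm_smul]
  inner u v := ∫ x in Ω, inner ℝ (grad u x) (grad v x)
  norm_sq_eq_re_inner u := by
    change ‖grad u‖ ^ 2 = ∫ x in Ω, inner ℝ (grad u x) (grad u x)
    rw [← L2.inner_def, real_inner_self_eq_norm_sq]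
  conj_inner_symm u v := by
    change ∫ x in Ω, inner ℝ (grad v x) (grad u x) = ∫ x in Ω, inner ℝ (grad u x) (grad v x)
    rw [← L2.inner_def, ← L2.inner_def, real_inner_comm]
  add_left u v w := by
    change ∫ x in Ω, inner ℝ (grad (u + v) x) (grad w x) =
      (∫ x in Ω, inner ℝ (grad u x) (grad w x)) + ∫ x in Ω, inner ℝ (grad v x) (grad w x)
    rw [← L2.inner_def, ← L2.inner_def, ← L2.inner_def, map_add, inner_add_left]
  smul_left u v c := by
    change ∫ x in Ω, inner ℝ (grad (c • u) x) (grad v x) =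
      c * ∫ x in Ω, inner ℝ (grad u x) (grad v x)
    rw [← L2.inner_def, ← L2.inner_def, map_smul, real_inner_smul_left]

end H1ZeroSpace

/-! ## The geometrical setting -/

/-- The sets `Υ_ij`: the outer part `Υ_ii` of the boundary of `Ω_i`, and, for `i ≠ j`, the interface
`Υ_ij = Υ_ji` of `Ω_i` and `Ω_j`, its interior being relative to the boundary of the subdomain
with the smaller index. -/
def interface {N m : ℕ} (Ω : Set (Eu N)) (sub : Fin m → Set (Eu N)) (i j : Fin m) :
    Set (Eu N) :=
  if i = j then relInterior (frontier Ω) (frontier (sub i) ∩ frontier Ω)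
  else relInterior (frontier (sub (min i j))) (frontier (sub i) ∩ frontier (sub j))

/-- The set `J(i)` of the indices of the neighbors of `Ω_i`. -/
def neighbors {N m : ℕ} (Ω : Set (Eu N)) (sub : Fin m → Set (Eu N)) (i : Fin m) :
    Set (Fin m) :=
  {j | j ≠ i ∧ (interface Ω sub i j).Nonempty}

/-- The geometrical setting: a bounded domain decomposed into `m ≥ 2` subdomains. -/
structure DomainDecomposition (N m : ℕ) where
  /-- the domain -/
  Ω : Set (Eu N)
  /-- the subdomains `Ω_i` -/
  sub : Fin m → Set (Eu N)
  two_le : 2 ≤ m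
  nonempty : Ω.Nonempty
  isOpen : IsOpen Ω
  isBounded : Bornology.IsBounded Ω
  lipschitz : HasLipschitzBoundary Ω
  sub_isOpen : ∀ i, IsOpen (sub i)
  sub_subset : ∀ i, sub i ⊆ Ω
  sub_disjoint : ∀ i j, i ≠ j → Disjoint (sub i) (sub j)
  sub_lipschitz : ∀ i, HasLipschitzBoundary (sub i)
  closure_eq : closure Ω = ⋃ i, closure (sub i)
  outer_nonempty : ∀ i, (interface Ω sub i i).Nonempty
  neighbors_nonempty : ∀ i, (neighbors Ω sub i).Nonempty

namespace DomainDecomposition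

variable {N m : ℕ} (D : DomainDecomposition N m)

/-- `Υ_ij`. -/
abbrev Ups (i j : Fin m) : Set (Eu N) := interface D.Ω D.sub i j

/-- `J(i)`. -/
abbrev J (i : Fin m) : Set (Fin m) := neighbors D.Ω D.sub i

/-- The space `H_i = H¹_{0,Υ_ii}(Ω_i)`, with the scalar product `∫ Du · Dv` over `Ω_i`. -/
abbrev H (i : Fin m) : Type := H1ZeroSpace (D.sub i) (D.Ups i i)

/-- The Hilbert direct sum `G_i` of the spaces `L²(Υ_ij)`, `j ∈ J(i)`. -/
abbrev G (i : Fin m) : Type := PiLp 2 (fun j : D.J i => L2Surf (D.Ups i j))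

/-- The restriction to `Ω_i` of a function in `L²(Ω)`. -/
def restr (i : Fin m) (f : L2 D.Ω) : L2 (D.sub i) :=
  ((Lp.memLp f).mono_measure (Measure.restrict_mono_set volume (D.sub_subset i))).toLp f

open Classical in
/-- `u ∈ H_i` is a weak solution of the problem `-Δu = f` on `Ω_i`, `u = 0` on `Υ_ii`,
`∂u/∂ν_i = h_j` on `Υ_ij` for the `j ∈ J(i)` with `j > i`, and `∂u/∂ν_i = -h_j` on `Υ_ij` for the
`j ∈ J(i)` with `j < i`: for every `v ∈ H_i`, `∫ Du · Dv` is the sum of `∫ f v` and of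
the integrals of `± h_j` times the trace of `v` over the interfaces. -/
def IsWeakSolution (i : Fin m) (f : L2 (D.sub i)) (h : D.G i) (u : D.H i) : Prop :=
  ∀ v : D.H i, ∫ x in D.sub i, inner ℝ (u.grad x) (v.grad x) =
    (∫ x in D.sub i, f x * v.fn x) +
      ∑ j : D.J i, (if i < j.1 then (1 : ℝ) else -1) *
        ∫ x in D.Ups i j, h j x * traceOp (D.sub i) v.toH1 x ∂(μHE[N - 1] : Measure (Eu N))

/-- The operator `Q_i`, which maps `(f, (h_j))` to the weak solution of the
Dirichlet-Neumann problem. -/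
def Q (i : Fin m) (p : L2 (D.sub i) × D.G i) : D.H i :=
  Classical.epsilon (D.IsWeakSolution i p.1 p.2)

end DomainDecomposition

end DomDec

end

/-! Everything rests on a Poincaré inequality: on `H_i` the full `H¹` norm is bounded by the
gradient norm. It is obtained from definiteness of the scalar product, without a compact embedding,
in two stages. First, modulo finitely many bounded functionals the `L²` norm is controlled by the
gradient (`isControlled_self`). A difference quotient estimate, proved by duality with test
functions (`lintegral_translate_sub_le`), bounds `u(· + h) - u` in `L²` by `|h| ‖Du‖`. Averaged over
`h`, it gives control on a ball up to the integral of `u` there (`isControlled_ball`). Near a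
boundary point, the Lipschitz graph condition allows a shift of the domain into a compact part of
itself, which finitely many balls cover (`exists_isControlled_nhds`). Second, an injective operator
that is bounded below up to a finite rank operator is bounded below (`exists_norm_le_of_injective`).
Applied to `(u, Du) ↦ Du` on the closed space of pairs with vanishing trace on `Υ_ii`, it removes
the functionals. Hence `H_i` is complete and `v ↦ ∫ f v` is bounded on it, so `q_i` is its Riesz
representative and `φ_i` is `ι_C + ½‖·‖² - ⟨q_i, ·⟩`. The formulas for the subdifferential and the
proximity operator then come from expanding and completing squares (`subdifferential_eq`,
`proxSet_eq_projSet`). -/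

open MeasureTheory Set Filter Topology
open scoped ContDiff Pointwise

noncomputable section

namespace DomDec

/-! ### Difference quotients of `H¹` functions. -/

section Translation

variable {N : ℕ} {Ω U : Set (Eu N)}

/-- A function in `L²(U)` whose pairing with the test functions is controlled by their norms has
a controlled norm. -/
lemma norm_le_of_forall_test (hU : IsOpen U) (w : L2 U) {M : ℝ}
    (h : ∀ φ : Eu N → ℝ, ContDiff ℝ ∞ φ → HasCompactSupport φ → tsupport φ ⊆ U →
      ∫ x in U, φ x * w x ≤ M * (eLpNorm φ 2 volume).toReal) (hM : 0 ≤ M) : ‖w‖ ≤ M := by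
  let S : Set (L2 U) := {v | ∃ φ : Eu N → ℝ, ContDiff ℝ ∞ φ ∧ HasCompactSupport φ ∧
    tsupport φ ⊆ U ∧ v =ᵐ[volume.restrict U] φ}
  have hpair : ∀ (v : L2 U) (φ : Eu N → ℝ), v =ᵐ[volume.restrict U] φ →
      inner ℝ v w = ∫ x in U, φ x * w x := by
    intro v φ hv
    rw [L2.inner_def]
    apply integral_congr_ae
    filter_upwards [hv] with x hx
    rw [hx, real_inner_eq_re_inner, RCLike.re_to_real]
    simp [mul_comm]
  have hle : ∀ v ∈ S, inner ℝ v w ≤ M * ‖v‖ := by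
    rintro v ⟨φ, h1, h2, h3, hv⟩
    rw [hpair v φ hv, Lp.norm_def, eLpNorm_congr_ae hv,
      eLpNorm_restrict_eq_of_support_subset ((subset_tsupport φ).trans h3)]
    exact h φ h1 h2 h3
  have hSsmul : ∀ (c : ℝ), ∀ v ∈ S, c • v ∈ S := by
    rintro c v ⟨φ, h1, h2, h3, hv⟩
    refine ⟨fun x => c * φ x, contDiff_const.mul h1, h2.mul_left,
      (tsupport_mul_subset_right (f := fun _ => c)).trans h3, ?_⟩
    filter_upwards [Lp.coeFn_smul c v, hv] with x hx hx'
    rw [hx, Pi.smul_apply, hx', smul_eq_mul]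
  have hSadd : ∀ u ∈ S, ∀ v ∈ S, u + v ∈ S := by
    rintro u ⟨φ, h1, h2, h3, hu⟩ v ⟨ψ, k1, k2, k3, hv⟩
    refine ⟨fun x => φ x + ψ x, h1.add k1, h2.add k2,
      (tsupport_add φ ψ).trans (union_subset h3 k3), ?_⟩
    filter_upwards [Lp.coeFn_add u v, hu, hv] with x hx hx' hx''
    rw [hx, Pi.add_apply, hx', hx'']
  let V : Submodule ℝ (L2 U) :=
    { carrier := S
      add_mem' := fun hu hv => hSadd _ hu _ hv
      zero_mem' := ⟨0, contDiff_const, HasCompactSupport.zero, by simp [tsupport],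
        Lp.coeFn_zero ℝ 2 (volume.restrict U)⟩
      smul_mem' := fun c v hv => hSsmul c v hv }
  -- Test functions are dense in `L²(U)`: a function orthogonal to all of them vanishes a.e. by the
  -- fundamental lemma of the calculus of variations.
  have hdense : V.topologicalClosure = ⊤ := by
    rw [Submodule.topologicalClosure_eq_top_iff, Submodule.eq_bot_iff]
    intro v hv
    have hloc : LocallyIntegrableOn (v : Eu N → ℝ) U volume :=
      locallyIntegrableOn_of_locallyIntegrable_restrict
        ((Lp.memLp v).locallyIntegrable one_le_two)
    have := hU.ae_eq_zero_of_integral_contDiff_smul_eq_zero hloc (fun φ h1 h2 h3 => by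
      have hφ : MemLp φ 2 (volume.restrict U) :=
        (h1.continuous.memLp_of_hasCompactSupport h2).restrict U
      have h0 := hv (hφ.toLp φ) ⟨φ, h1, h2, h3, hφ.coeFn_toLp⟩
      rw [L2.inner_def] at h0
      rw [← setIntegral_eq_integral_of_forall_compl_eq_zero (s := U), ← h0]
      · apply integral_congr_ae
        filter_upwards [hφ.coeFn_toLp] with x hx
        rw [hx]
        simp [mul_comm]
      · intro x hx
        rw [image_eq_zero_of_notMem_tsupport (fun h => hx (h3 h)), zero_smul])
    apply Lp.ext
    filter_upwards [(ae_restrict_iff' hU.measurableSet).2 this,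
      Lp.coeFn_zero ℝ 2 (volume.restrict U)] with x hx hx'
    rw [hx, hx', Pi.zero_apply]
  -- By density the bound passes to the limit and may be tested on `w` itself, which gives `‖w‖² ≤
  -- M‖w‖`.
  have hw : w ∈ closure (V : Set (L2 U)) := by
    have : w ∈ V.topologicalClosure := hdense ▸ Submodule.mem_top
    exact this
  have hcl : IsClosed {v : L2 U | inner ℝ v w ≤ M * ‖v‖} :=
    isClosed_le (by fun_prop) (by fun_prop)
  have hmem : inner ℝ w w ≤ M * ‖w‖ := closure_minimal hle hcl hw
  rw [real_inner_self_eq_norm_mul_norm] at hmem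
  by_contra! hlt
  nlinarith [norm_nonneg w]

lemma abs_integral_mul_inner_le (g : L2Vec Ω) {θ : Eu N → ℝ}
    (hθ : MemLp θ 2 volume) (y : Eu N) :
    |∫ x in Ω, θ x * inner ℝ (g x) y| ≤ ‖y‖ * ‖g‖ * (eLpNorm θ 2 volume).toReal := by
  have hm : MemLp (fun x => θ x • y) 2 (volume.restrict Ω) :=
    (ContinuousLinearMap.toSpanSingleton ℝ y).comp_memLp' (hθ.restrict Ω)
  have e : ∫ x in Ω, θ x * inner ℝ (g x) y = inner ℝ g (hm.toLp _) := by
    rw [L2.inner_def]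
    apply integral_congr_ae
    filter_upwards [hm.coeFn_toLp] with x hx
    rw [hx, real_inner_smul_right]
  rw [e]
  refine (abs_real_inner_le_norm _ _).trans ?_
  have : ‖hm.toLp _‖ ≤ ‖y‖ * (eLpNorm θ 2 volume).toReal := by
    rw [Lp.norm_toLp, ← toReal_enorm y, ← ENNReal.toReal_mul]
    apply ENNReal.toReal_mono (ENNReal.mul_ne_top (by simp) hθ.eLpNorm_ne_top)
    refine (eLpNorm_mono_measure _ Measure.restrict_le_self).trans ?_
    refine eLpNorm_le_nnreal_smul_eLpNorm_of_ae_le_mul (c := ‖y‖₊) ?_ 2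
    filter_upwards with x
    rw [nnnorm_smul, mul_comm]
  nlinarith [norm_nonneg g]

/-- Integral form of the mean value inequality along `h`, tested with `φ`. -/
lemma integral_mul_translate_sub_le (hΩ : volume Ω ≠ ⊤) (p : H1 Ω) (h : Eu N)
    {φ : Eu N → ℝ} (h1 : ContDiff ℝ ∞ φ) (h2 : HasCompactSupport φ)
    (h3 : ∀ x ∈ tsupport φ, ∀ s ∈ Icc (0 : ℝ) 1, x + s • h ∈ Ω) :
    |(∫ x in Ω, p.1.fst x * φ (x - h)) - ∫ x in Ω, p.1.fst x * φ x| ≤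
      ‖h‖ * ‖p.1.snd‖ * (eLpNorm φ 2 volume).toReal := by
  have : IsFiniteMeasure (volume.restrict Ω) := ⟨by simpa using hΩ.lt_top⟩
  let φs : ℝ → Eu N → ℝ := fun s x => φ (x - s • h)
  have c1 : ∀ s, ContDiff ℝ ∞ (φs s) := fun s => h1.comp (contDiff_id.sub contDiff_const)
  have c2 : ∀ s, HasCompactSupport (φs s) := fun s => by
    have := h2.comp_homeomorph (Homeomorph.subRight (s • h))
    exact this
  have c3 : ∀ s ∈ Icc (0 : ℝ) 1, tsupport (φs s) ⊆ Ω := by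
    intro s hs x hx
    have hx' : x - s • h ∈ tsupport φ :=
      (tsupport_comp_subset_preimage φ (f := fun x : Eu N => x - s • h) (by fun_prop)) hx
    simpa using h3 _ hx' s hs
  have c4 : ∀ s, eLpNorm (φs s) 2 volume = eLpNorm φ 2 volume := fun s =>
    eLpNorm_comp_measurePreserving (μ := volume) h1.continuous.aestronglyMeasurable
      (measurePreserving_sub_right volume (s • h))
  have hint : ∀ s, Integrable (fun x => p.1.fst x * φs s x) (volume.restrict Ω) := fun s =>
    integrable_mul_test _ (c1 s).continuous (c2 s)
  have hfd : ∀ s x, fderiv ℝ (φs s) x = fderiv ℝ φ (x - s • h) := fun s x =>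
    fderiv_comp_sub (f := φ) (x := x) (s • h)
  obtain ⟨B, hB⟩ := ((h1.continuous_fderiv (by simp)).clm_apply
    (continuous_const (y := h))).bounded_above_of_compact_support (h2.fderiv_apply ℝ h)
  -- Only the test function depends on `s`, so the integral is differentiable in `s` although `u`
  -- has no pointwise derivative. The dominating function `B|u|` is integrable since `Ω` has finite
  -- measure.
  have hderiv : ∀ s, HasDerivAt (fun s => ∫ x in Ω, p.1.fst x * φs s x)
      (∫ x in Ω, p.1.fst x * -(fderiv ℝ φ (x - s • h) h)) s := by
    intro s
    refine (hasDerivAt_integral_of_dominated_loc_of_deriv_le (μ := volume.restrict Ω)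
      (F := fun s x => p.1.fst x * φs s x)
      (F' := fun s x => p.1.fst x * -(fderiv ℝ φ (x - s • h) h))
      (bound := fun x => ‖p.1.fst x‖ * B) univ_mem
      (Eventually.of_forall fun s => (hint s).aestronglyMeasurable) (hint s) ?_ ?_ ?_ ?_).2
    · have := (integrable_mul_fderiv p.1.fst (c1 s) (c2 s) h).neg.aestronglyMeasurable
      refine this.congr (Eventually.of_forall fun x => ?_)
      simp [hfd]
    · filter_upwards with x t _
      rw [norm_mul, norm_neg]
      exact mul_le_mul_of_nonneg_left (hB _) (norm_nonneg _)
    · exact ((Lp.memLp p.1.fst).integrable one_le_two).norm.mul_const B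
    · filter_upwards with x t _
      apply HasDerivAt.const_mul
      have hd : HasDerivAt (fun t : ℝ => x - t • h) (-h) t := by
        simpa using ((hasDerivAt_id t).smul_const h).const_sub x
      have hf := (h1.differentiable (by simp) (x - t • h)).hasFDerivAt
      have := hf.comp_hasDerivAt t hd
      rw [map_neg] at this
      exact this
  -- The shifted test function is supported in `Ω` for every `s` in `[0, 1]`, so the weak gradient
  -- turns the derivative into `∫ φ_s Du · h`, which Cauchy-Schwarz bounds uniformly in `s`.
  have := norm_image_sub_le_of_norm_deriv_le_segment_01'
    (f := fun s => ∫ x in Ω, p.1.fst x * φs s x)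
    (C := ‖h‖ * ‖p.1.snd‖ * (eLpNorm φ 2 volume).toReal)
    (fun s _ => (hderiv s).hasDerivWithinAt) (fun s hs => by
      have hs' : s ∈ Icc (0 : ℝ) 1 := ⟨hs.1, hs.2.le⟩
      have e := p.2 (φs s) (c1 s) (c2 s) (c3 s hs') h
      simp only [hfd] at e
      simp only [mul_neg, integral_neg]
      rw [e, neg_neg, Real.norm_eq_abs, ← c4 s]
      exact abs_integral_mul_inner_le _
        ((c1 s).continuous.memLp_of_hasCompactSupport (c2 s)) h)
  simpa [φs] using this

/-- Translation estimate for functions in `H¹`. -/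
lemma lintegral_translate_sub_le (hΩo : IsOpen Ω) (hΩ : volume Ω ≠ ⊤) (hU : IsOpen U) (p : H1 Ω)
    (h : Eu N) (hUΩ : ∀ x ∈ U, ∀ s ∈ Icc (0 : ℝ) 1, x + s • h ∈ Ω) :
    ∫⁻ x in U, ENNReal.ofReal ((p.1.fst (x + h) - p.1.fst x) ^ 2) ≤
      ENNReal.ofReal (‖h‖ ^ 2 * ‖p.1.snd‖ ^ 2) := by
  have hUΩ0 : U ⊆ Ω := fun x hx => by simpa using hUΩ x hx 0 (by simp)
  have hUΩ1 : ∀ x ∈ U, x + h ∈ Ω := fun x hx => by simpa using hUΩ x hx 1 (by simp)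
  have hpre : MeasurePreserving (fun x : Eu N => x + h)
      (volume.restrict ((fun x => x + h) ⁻¹' Ω)) (volume.restrict Ω) :=
    (measurePreserving_add_right volume h).restrict_preimage hΩo.measurableSet
  have m1 : MemLp (fun x => p.1.fst (x + h)) 2 (volume.restrict U) :=
    ((Lp.memLp p.1.fst).comp_measurePreserving hpre).mono_measure
      (Measure.restrict_mono_set volume hUΩ1)
  have m0 : MemLp (fun x => p.1.fst x) 2 (volume.restrict U) :=
    (Lp.memLp p.1.fst).mono_measure (Measure.restrict_mono_set volume hUΩ0)
  have m : MemLp (fun x => p.1.fst (x + h) - p.1.fst x) 2 (volume.restrict U) := m1.sub m0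
  -- Duality: paired with a test function, the shift by `h` is moved from `u` onto the test
  -- function.
  have key : ‖m.toLp _‖ ≤ ‖h‖ * ‖p.1.snd‖ := by
    refine norm_le_of_forall_test hU _ (fun φ h1 h2 h3 => ?_) (by positivity)
    refine le_trans (le_of_eq ?_) (((le_abs_self _).trans (integral_mul_translate_sub_le hΩ p h h1 h2
      (fun x hx => hUΩ x (h3 hx)))))
    have hφ : MemLp φ 2 (volume.restrict U) :=
      (h1.continuous.memLp_of_hasCompactSupport h2).restrict U
    have hz : ∀ x, x ∉ U → φ x = 0 := fun x hx =>
      image_eq_zero_of_notMem_tsupport (fun h => hx (h3 h))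
    have e1 : ∫ x in Ω, p.1.fst x * φ (x - h) = ∫ x in U, p.1.fst (x + h) * φ x := by
      rw [← hpre.integral_comp (MeasurableEquiv.addRight h).measurableEmbedding]
      simp only [add_sub_cancel_right]
      refine setIntegral_eq_of_subset_of_forall_sdiff_eq_zero
        ((measurable_id.add_const h) hΩo.measurableSet) hUΩ1 ?_
      rintro x ⟨-, hx⟩
      rw [hz x hx, mul_zero]
    have e0 : ∫ x in Ω, p.1.fst x * φ x = ∫ x in U, p.1.fst x * φ x := by
      refine setIntegral_eq_of_subset_of_forall_sdiff_eq_zero hΩo.measurableSet hUΩ0 ?_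
      rintro x ⟨-, hx⟩
      rw [hz x hx, mul_zero]
    have i1 : Integrable (fun x => p.1.fst (x + h) * φ x) (volume.restrict U) :=
      m1.integrable_mul hφ
    have i0 : Integrable (fun x => p.1.fst x * φ x) (volume.restrict U) := m0.integrable_mul hφ
    rw [e1, e0, ← integral_sub i1 i0]
    apply integral_congr_ae
    filter_upwards [m.coeFn_toLp] with x hx
    rw [hx]
    ring
  have hsq : ‖m.toLp _‖ ^ 2 = ∫ x in U, (p.1.fst (x + h) - p.1.fst x) ^ 2 := by
    rw [← real_inner_self_eq_norm_sq, L2.inner_def]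
    apply integral_congr_ae
    filter_upwards [m.coeFn_toLp] with x hx
    rw [hx, real_inner_self_eq_norm_sq, Real.norm_eq_abs, sq_abs]
  rw [← ofReal_integral_eq_lintegral_ofReal m.integrable_sq
    (Eventually.of_forall fun x => sq_nonneg _), ← hsq, ← mul_pow]
  exact ENNReal.ofReal_le_ofReal (pow_le_pow_left₀ (norm_nonneg _) key 2)

end Translation

/-! ### Control of the `L²` norm by the gradient and finitely many functionals. -/

section Poincare

variable {N : ℕ} {Ω : Set (Eu N)}

/-- With `y = x + h` and the order of integration exchanged, the translation estimate applies for
each fixed `h`; only the `h` with `|h| < 2r` contribute, whence the volume factor. -/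
lemma lintegral_lintegral_ball_sub_le (hΩo : IsOpen Ω) (hΩ : volume Ω ≠ ⊤) {c : Eu N} {r : ℝ}
    (hB : Metric.ball c r ⊆ Ω) (p : H1 Ω) :
    ∫⁻ x in Metric.ball c r, ∫⁻ y in Metric.ball c r,
        ENNReal.ofReal ((p.1.fst y - p.1.fst x) ^ 2) ≤
      volume (Metric.ball (0 : Eu N) (2 * r)) *
        ENNReal.ofReal ((2 * r) ^ 2 * ‖p.1.snd‖ ^ 2) := by
  set B := Metric.ball c r with hBdef
  have hBm : MeasurableSet B := Metric.isOpen_ball.measurableSet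
  have hu : Measurable (p.1.fst : Eu N → ℝ) := (Lp.stronglyMeasurable p.1.fst).measurable
  have e1 : ∀ x, ∫⁻ y in B, ENNReal.ofReal ((p.1.fst y - p.1.fst x) ^ 2) =
      ∫⁻ h, B.indicator (fun z => ENNReal.ofReal ((p.1.fst z - p.1.fst x) ^ 2)) (x + h) := by
    intro x
    rw [← lintegral_indicator hBm, lintegral_add_left_eq_self]
  simp only [e1]
  have hmeas : Measurable (fun q : Eu N × Eu N =>
      B.indicator (fun z => ENNReal.ofReal ((p.1.fst z - p.1.fst q.1) ^ 2)) (q.1 + q.2)) := by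
    have : (fun q : Eu N × Eu N =>
        B.indicator (fun z => ENNReal.ofReal ((p.1.fst z - p.1.fst q.1) ^ 2)) (q.1 + q.2)) =
        ((fun q : Eu N × Eu N => q.1 + q.2) ⁻¹' B).indicator
          (fun q => ENNReal.ofReal ((p.1.fst (q.1 + q.2) - p.1.fst q.1) ^ 2)) := by
      rfl
    rw [this]
    exact Measurable.indicator (by fun_prop) ((by fun_prop : Measurable fun q : Eu N × Eu N =>
      q.1 + q.2) hBm)
  rw [lintegral_lintegral_swap hmeas.aemeasurable]
  rw [mul_comm, ← setLIntegral_const, ← lintegral_indicator Metric.isOpen_ball.measurableSet]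
  refine lintegral_mono fun h => ?_
  have e2 : ∫⁻ x in B, B.indicator
      (fun z => ENNReal.ofReal ((p.1.fst z - p.1.fst x) ^ 2)) (x + h) =
      ∫⁻ x in B ∩ (fun x => x + h) ⁻¹' B,
        ENNReal.ofReal ((p.1.fst (x + h) - p.1.fst x) ^ 2) := by
    rw [inter_comm, ← Measure.restrict_restrict ((by fun_prop : Measurable fun x => x + h) hBm),
      ← lintegral_indicator ((by fun_prop : Measurable fun x => x + h) hBm)]
    rfl
  have hopen : IsOpen (B ∩ (fun x => x + h) ⁻¹' B) :=
    Metric.isOpen_ball.inter (Metric.isOpen_ball.preimage (by fun_prop))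
  rw [e2]
  by_cases hh : h ∈ Metric.ball (0 : Eu N) (2 * r)
  · rw [indicator_of_mem hh]
    refine (lintegral_translate_sub_le hΩo hΩ hopen p h ?_).trans (ENNReal.ofReal_le_ofReal ?_)
    -- Convexity of the ball keeps the segment from `x` to `x + h` inside `Ω`.
    · rintro x ⟨hx, hxh⟩ s hs
      apply hB
      have := (convex_ball c r) hx hxh (sub_nonneg.2 hs.2) hs.1 (by ring)
      convert this using 1
      simp only [smul_add, sub_smul, one_smul]
      abel
    · rw [mem_ball_zero_iff] at hh
      gcongr
  · have hempty : B ∩ (fun x => x + h) ⁻¹' B = ∅ := by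
      rw [eq_empty_iff_forall_notMem]
      rintro x ⟨hx, hxh⟩
      apply hh
      rw [mem_ball_zero_iff]
      have h1 : dist x c < r := hx
      have h2 : dist (x + h) c < r := hxh
      have h3 := dist_triangle_right (x + h) x c
      rw [dist_eq_norm, add_sub_cancel_left] at h3
      linarith
    rw [hempty]
    simp

lemma ofReal_integral_le_lintegral {X : Type*} [MeasurableSpace X] {μ : Measure X} {f : X → ℝ}
    (hf : ∀ x, 0 ≤ f x) : ENNReal.ofReal (∫ x, f x ∂μ) ≤ ∫⁻ x, ENNReal.ofReal (f x) ∂μ := by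
  rw [← Real.enorm_eq_ofReal (integral_nonneg hf)]
  refine (enorm_integral_le_lintegral_enorm f).trans (le_of_eq ?_)
  exact lintegral_congr fun x => Real.enorm_eq_ofReal (hf x)

/-- Variance identity. -/
lemma measureReal_mul_integral_sq {X : Type*} [MeasurableSpace X] {μ : Measure X}
    [IsFiniteMeasure μ] {u : X → ℝ} (hu : MemLp u 2 μ) :
    ∫ x, ∫ y, (u y - u x) ^ 2 ∂μ ∂μ =
      2 * (μ.real univ * ∫ x, u x ^ 2 ∂μ) - 2 * (∫ x, u x ∂μ) ^ 2 := by
  have i1 : Integrable u μ := hu.integrable one_le_two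
  have i2 : Integrable (fun x => u x ^ 2) μ := hu.integrable_sq
  have inner_eq : ∀ x, ∫ y, (u y - u x) ^ 2 ∂μ =
      (∫ y, u y ^ 2 ∂μ) - 2 * (∫ y, u y ∂μ) * u x + μ.real univ * u x ^ 2 := by
    intro x
    have : (fun y => (u y - u x) ^ 2) = fun y => (u y ^ 2 - (2 * u x) * u y) + u x ^ 2 := by
      ext y; ring
    have i3 : Integrable (fun y => u y ^ 2 - (2 * u x) * u y) μ := i2.sub (i1.const_mul _)
    rw [this, integral_add i3 (integrable_const _),
      integral_sub i2 (i1.const_mul _), integral_const_mul, integral_const, smul_eq_mul]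
    ring
  simp only [inner_eq]
  have i3 : Integrable (fun x => (∫ y, u y ^ 2 ∂μ) - 2 * (∫ y, u y ∂μ) * u x) μ :=
    (integrable_const _).sub (i1.const_mul _)
  rw [integral_add i3 (i2.const_mul _),
    integral_sub (integrable_const _) (i1.const_mul _), integral_const_mul, integral_const_mul,
    integral_const, smul_eq_mul]
  ring

/-- On `S`, the `L²` norm of an `H¹` function is controlled by its gradient and by finitely many
functionals. -/
def IsControlled (Ω S : Set (Eu N)) : Prop :=
  ∃ (F : Finset (L2 Ω)) (C : ℝ), 0 ≤ C ∧ ∀ p : H1 Ω,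
    ∫⁻ x in S, ENNReal.ofReal (p.1.fst x ^ 2) ≤
      ENNReal.ofReal (C * (‖p.1.snd‖ ^ 2 + ∑ w ∈ F, (inner ℝ w p.1.fst) ^ 2))

lemma IsControlled.mono {S T : Set (Eu N)} (h : S ⊆ T) (hT : IsControlled Ω T) :
    IsControlled Ω S := by
  obtain ⟨F, C, hC, hF⟩ := hT
  exact ⟨F, C, hC, fun p => (lintegral_mono_set h).trans (hF p)⟩

lemma isControlled_empty : IsControlled Ω ∅ := ⟨∅, 0, le_rfl, fun p => by simp⟩

lemma IsControlled.union {S T : Set (Eu N)} (hS : IsControlled Ω S) (hT : IsControlled Ω T) :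
    IsControlled Ω (S ∪ T) := by
  classical
  obtain ⟨F, C, hC, hF⟩ := hS
  obtain ⟨G, K, hK, hG⟩ := hT
  refine ⟨F ∪ G, C + K, add_nonneg hC hK, fun p => ?_⟩
  refine (lintegral_union_le _ _ _).trans ((add_le_add (hF p) (hG p)).trans ?_)
  rw [← ENNReal.ofReal_add (by positivity) (by positivity), add_mul]
  have h1 : ∑ w ∈ F, (inner ℝ w p.1.fst) ^ 2 ≤ ∑ w ∈ F ∪ G, (inner ℝ w p.1.fst) ^ 2 :=
    Finset.sum_le_sum_of_subset_of_nonneg Finset.subset_union_left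
      fun _ _ _ => sq_nonneg _
  have h2 : ∑ w ∈ G, (inner ℝ w p.1.fst) ^ 2 ≤ ∑ w ∈ F ∪ G, (inner ℝ w p.1.fst) ^ 2 :=
    Finset.sum_le_sum_of_subset_of_nonneg Finset.subset_union_right
      fun _ _ _ => sq_nonneg _
  apply ENNReal.ofReal_le_ofReal
  gcongr

/-- Poincaré inequality on balls. -/
lemma isControlled_ball (hΩo : IsOpen Ω) (hΩ : volume Ω ≠ ⊤) {c : Eu N} {r : ℝ} (hr : 0 < r)
    (hB : Metric.ball c r ⊆ Ω) : IsControlled Ω (Metric.ball c r) := by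
  classical
  set B := Metric.ball c r with hBdef
  have hBm : MeasurableSet B := Metric.isOpen_ball.measurableSet
  have hBfin : volume B ≠ ⊤ := measure_ball_lt_top.ne
  have hBΩfin : (volume.restrict Ω) B ≠ ⊤ :=
    ((Measure.restrict_apply_le Ω B).trans_lt measure_ball_lt_top).ne
  have : IsFiniteMeasure (volume.restrict B) := ⟨by simpa using hBfin.lt_top⟩
  set b := volume.real B with hb
  have hbpos : 0 < b := ENNReal.toReal_pos (Metric.measure_ball_pos volume c hr).ne' hBfin
  set V := volume.real (Metric.ball (0 : Eu N) (2 * r)) with hV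
  have hVnn : 0 ≤ V := measureReal_nonneg
  -- The only functional needed is the integral of `u` over the ball. By the variance identity, `b ∫
  -- u²` is half the double integral of `(u y - u x)²` plus the square of that integral.
  refine ⟨{indicatorConstLp 2 hBm hBΩfin (1 : ℝ)}, (V * (2 * r) ^ 2 + 1) / b, by positivity,
    fun p => ?_⟩
  have hu : MemLp (fun x => p.1.fst x) 2 (volume.restrict B) :=
    (Lp.memLp p.1.fst).mono_measure (Measure.restrict_mono_set volume hB)
  have i1 := hu.integrable one_le_two
  have hmean : inner ℝ (indicatorConstLp 2 hBm hBΩfin (1 : ℝ)) p.1.fst =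
      ∫ x in B, p.1.fst x := by
    rw [L2.inner_indicatorConstLp_one, Measure.restrict_restrict hBm, inter_eq_left.2 hB]
  rw [Finset.sum_singleton, hmean, ← ofReal_integral_eq_lintegral_ofReal hu.integrable_sq
    (Eventually.of_forall fun x => sq_nonneg _)]
  apply ENNReal.ofReal_le_ofReal
  have hid := measureReal_mul_integral_sq hu
  rw [measureReal_restrict_apply_univ] at hid
  have hdouble : ∫ x in B, ∫ y in B, (p.1.fst y - p.1.fst x) ^ 2 ≤
      V * ((2 * r) ^ 2 * ‖p.1.snd‖ ^ 2) := by
    rw [← ENNReal.ofReal_le_ofReal_iff (by positivity), ENNReal.ofReal_mul hVnn, hV,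
      ofReal_measureReal measure_ball_lt_top.ne]
    refine le_trans ?_ (lintegral_lintegral_ball_sub_le hΩo hΩ hB p)
    refine (ofReal_integral_le_lintegral fun x => integral_nonneg fun y => sq_nonneg _).trans ?_
    exact lintegral_mono fun x => ofReal_integral_le_lintegral fun y => sq_nonneg _
  rw [div_mul_eq_mul_div, le_div_iff₀ hbpos]
  have : 0 ≤ V * ((2 * r) ^ 2) := by positivity
  nlinarith [sq_nonneg (∫ x in B, p.1.fst x), sq_nonneg ‖p.1.snd‖,
    mul_nonneg this (sq_nonneg (∫ x in B, p.1.fst x)), mul_nonneg this (sq_nonneg ‖p.1.snd‖)]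

lemma isControlled_of_isCompact (hΩo : IsOpen Ω) (hΩ : volume Ω ≠ ⊤) {K : Set (Eu N)}
    (hK : IsCompact K) (hKΩ : K ⊆ Ω) : IsControlled Ω K := by
  refine hK.induction_on isControlled_empty (fun _ _ h => IsControlled.mono h)
    (fun _ _ => IsControlled.union) fun x hx => ?_
  obtain ⟨r, hr, hB⟩ := Metric.isOpen_iff.1 hΩo x (hKΩ hx)
  exact ⟨Metric.ball x r, mem_nhdsWithin_of_mem_nhds (Metric.ball_mem_nhds x hr),
    isControlled_ball hΩo hΩ hr hB⟩

/-- Since `u(x)² ≤ 2u(x + h)² + 2(u(x + h) - u(x))²`, control on `U + h` and the translation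
estimate give control on `U`. -/
lemma IsControlled.of_translate (hΩo : IsOpen Ω) (hΩ : volume Ω ≠ ⊤) {U : Set (Eu N)}
    (hU : IsOpen U) {h : Eu N} (hUΩ : ∀ x ∈ U, ∀ s ∈ Icc (0 : ℝ) 1, x + s • h ∈ Ω)
    (hT : IsControlled Ω ((fun x => x - h) ⁻¹' U)) : IsControlled Ω U := by
  obtain ⟨F, C, hC, hF⟩ := hT
  refine ⟨F, 2 * C + 2 * ‖h‖ ^ 2, by positivity, fun p => ?_⟩
  have hu : Measurable (p.1.fst : Eu N → ℝ) := (Lp.stronglyMeasurable p.1.fst).measurable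
  have e : ∫⁻ x in (fun x => x - h) ⁻¹' U, ENNReal.ofReal (p.1.fst x ^ 2) =
      ∫⁻ x in U, ENNReal.ofReal (p.1.fst (x + h) ^ 2) := by
    have := (measurePreserving_sub_right volume h).setLIntegral_comp_preimage hU.measurableSet
      (f := fun x => ENNReal.ofReal (p.1.fst (x + h) ^ 2)) (by fun_prop)
    simpa using this
  have hpt : ∀ x, ENNReal.ofReal (p.1.fst x ^ 2) ≤
      ENNReal.ofReal 2 * ENNReal.ofReal (p.1.fst (x + h) ^ 2) +
      ENNReal.ofReal 2 * ENNReal.ofReal ((p.1.fst (x + h) - p.1.fst x) ^ 2) := by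
    intro x
    rw [← ENNReal.ofReal_mul zero_le_two, ← ENNReal.ofReal_mul zero_le_two,
      ← ENNReal.ofReal_add (by positivity) (by positivity)]
    apply ENNReal.ofReal_le_ofReal
    nlinarith [sq_nonneg (p.1.fst (x + h) + (p.1.fst (x + h) - p.1.fst x))]
  refine (lintegral_mono hpt).trans ?_
  rw [lintegral_add_left (by fun_prop), lintegral_const_mul _ (by fun_prop),
    lintegral_const_mul _ (by fun_prop), ← e]
  refine (add_le_add (mul_le_mul_right (hF p) _)
    (mul_le_mul_right (lintegral_translate_sub_le hΩo hΩ hU p h hUΩ) _)).trans ?_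
  have hsum : 0 ≤ ∑ w ∈ F, (inner ℝ w p.1.fst) ^ 2 := Finset.sum_nonneg fun _ _ => sq_nonneg _
  rw [← ENNReal.ofReal_mul zero_le_two, ← ENNReal.ofReal_mul zero_le_two,
    ← ENNReal.ofReal_add (by positivity) (by positivity)]
  apply ENNReal.ofReal_le_ofReal
  have := mul_nonneg (sq_nonneg ‖h‖) hsum
  linarith

/-- Moving `Ω` near `x₀` by `τ` in the direction `e` raises it at least `τ` above the graph, hence
into a compact subset of `Ω`, where control is already known. -/
lemma exists_isControlled_nhds (hΩo : IsOpen Ω) (hΩ : volume Ω ≠ ⊤)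
    (hLip : HasLipschitzBoundary Ω) {x₀ : Eu N} (hx₀ : x₀ ∈ frontier Ω) :
    ∃ t ∈ 𝓝 x₀, IsControlled Ω (t ∩ Ω) := by
  obtain ⟨e, g, he, ⟨K, hg⟩, hinv, hev⟩ := hLip x₀ hx₀
  obtain ⟨r, hr, hball⟩ := Metric.eventually_nhds_iff.1 hev
  -- A shift of at most `r / 2` from the ball of radius `r / 4` stays where the graph description is
  -- valid.
  set τ := r / 2 with hτ
  have hτ0 : 0 < τ := half_pos hr
  have hee : ∀ (x : Eu N) (s : ℝ), inner ℝ e (x + s • e) = inner ℝ e x + s := by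
    intro x s
    rw [inner_add_right, real_inner_smul_right, real_inner_self_eq_norm_sq, he]
    ring
  have hdist : ∀ x : Eu N, dist x x₀ ≤ r / 4 → ∀ s ∈ Icc 0 τ, dist (x + s • e) x₀ < r := by
    intro x hx s hs
    have h1 := dist_triangle (x + s • e) x x₀
    rw [dist_eq_norm (x + s • e) x, add_sub_cancel_left, norm_smul, he, mul_one,
      Real.norm_of_nonneg hs.1] at h1
    linarith [hs.2]
  refine ⟨Metric.ball x₀ (r / 4), Metric.ball_mem_nhds _ (by positivity), ?_⟩
  refine IsControlled.of_translate hΩo hΩ (Metric.isOpen_ball.inter hΩo) (h := τ • e) ?_ ?_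
  · rintro x ⟨hx, hxΩ⟩ s hs
    rw [smul_smul]
    have hx' : dist x x₀ < r / 4 := hx
    have hgx := (hball (by linarith : dist x x₀ < r)).1 hxΩ
    refine (hball (hdist x hx'.le (s * τ) ⟨mul_nonneg hs.1 hτ0.le, ?_⟩)).2 ?_
    · nlinarith [hs.2]
    · rw [hinv, hee]
      nlinarith [mul_nonneg hs.1 hτ0.le]
  · let K' : Set (Eu N) := {y | dist (y - τ • e) x₀ ≤ r / 4 ∧ g y + τ ≤ inner ℝ e y}
    have hKc : IsCompact K' := by
      refine Metric.isCompact_of_isClosed_isBounded ?_ ?_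
      · have c1 : Continuous fun y : Eu N => dist (y - τ • e) x₀ := by fun_prop
        have c2 : Continuous fun y : Eu N => (inner ℝ e y : ℝ) := by fun_prop
        exact (isClosed_le c1 continuous_const).inter
          (isClosed_le (hg.continuous.add continuous_const) c2)
      · refine (Metric.isBounded_closedBall (x := x₀ + τ • e) (r := r / 4)).subset ?_
        rintro y ⟨hy, -⟩
        rw [Metric.mem_closedBall]
        convert hy using 1
        rw [dist_eq_norm, dist_eq_norm]
        congr 1
        abel
    have hKΩ : K' ⊆ Ω := by
      rintro y ⟨hy, hgy⟩
      have := hdist _ hy τ ⟨hτ0.le, le_rfl⟩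
      rw [sub_add_cancel] at this
      exact (hball this).2 (by linarith)
    refine (isControlled_of_isCompact hΩo hΩ hKc hKΩ).mono ?_
    rintro y ⟨hy, hyΩ⟩
    have hy' : dist (y - τ • e) x₀ < r / 4 := hy
    refine ⟨hy'.le, ?_⟩
    have h1 := (hball (by linarith : dist (y - τ • e) x₀ < r)).1 hyΩ
    have h2 := hee (y - τ • e) τ
    have h3 := hinv (y - τ • e) τ
    rw [sub_add_cancel] at h2 h3
    linarith

/-- On a bounded open set with Lipschitz boundary, the `L²` norm is controlled by the gradient and
by finitely many functionals. -/
lemma isControlled_self (hΩo : IsOpen Ω) (hb : Bornology.IsBounded Ω)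
    (hLip : HasLipschitzBoundary Ω) : IsControlled Ω Ω := by
  have hΩ : volume Ω ≠ ⊤ := hb.measure_lt_top.ne
  have : IsControlled Ω (closure Ω ∩ Ω) := by
    refine hb.isCompact_closure.induction_on (p := fun S => IsControlled Ω (S ∩ Ω)) ?_
      (fun _ _ h => IsControlled.mono (inter_subset_inter_left _ h)) (fun _ _ h1 h2 => ?_)
      fun x hx => ?_
    · rw [empty_inter]
      exact isControlled_empty
    · rw [union_inter_distrib_right]
      exact h1.union h2
    · by_cases hxΩ : x ∈ Ω
      · obtain ⟨r, hr, hB⟩ := Metric.isOpen_iff.1 hΩo x hxΩ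
        exact ⟨Metric.ball x r, mem_nhdsWithin_of_mem_nhds (Metric.ball_mem_nhds x hr),
          (isControlled_ball hΩo hΩ hr hB).mono inter_subset_left⟩
      · obtain ⟨t, ht, hc⟩ := exists_isControlled_nhds hΩo hΩ hLip
          (x₀ := x) (by rw [hΩo.frontier_eq]; exact ⟨hx, hxΩ⟩)
        exact ⟨t, mem_nhdsWithin_of_mem_nhds ht, hc⟩
  exact this.mono (subset_inter subset_closure Subset.rfl)

end Poincare

/-! ### Convex analysis of a quadratic function plus an indicator. -/

section HilbertConvex

lemma indic_add_of_mem {H : Type*} {C : Set H} {u : H} (hu : u ∈ C) (r : ℝ) :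
    indic C u + (r : EReal) = r := by
  rw [indic, if_pos hu, zero_add]

lemma indic_add_of_notMem {H : Type*} {C : Set H} {u : H} (hu : u ∉ C) (r : ℝ) :
    indic C u + (r : EReal) = ⊤ := by
  rw [indic, if_neg hu, EReal.top_add_coe]

variable {H : Type*} [SeminormedAddCommGroup H] [InnerProductSpace ℝ H]

/-- The normed group structure of a seminormed space whose scalar product is definite. -/
abbrev normedOfDefinite (hpos : ∀ u : H, inner ℝ u u = 0 → u = 0) : NormedAddCommGroup H :=
  NormedAddCommGroup.ofSeparation fun u hu => hpos u (by rw [real_inner_self_eq_norm_sq, hu]; simp)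

/-- Riesz representation. -/
lemma exists_inner_eq [CompleteSpace H] (hpos : ∀ u : H, inner ℝ u u = 0 → u = 0)
    (ℓ : H →L[ℝ] ℝ) : ∃ q : H, ∀ v, inner ℝ q v = ℓ v := by
  let := normedOfDefinite hpos
  exact ⟨(InnerProductSpace.toDual ℝ H).symm ℓ, fun v =>
    InnerProductSpace.toDual_symm_apply⟩

lemma eq_of_forall_inner_eq (hpos : ∀ u : H, inner ℝ u u = 0 → u = 0) {p q : H}
    (h : ∀ v : H, inner ℝ p v = inner ℝ q v) : p = q := by
  rw [← sub_eq_zero]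
  apply hpos
  rw [inner_sub_left, h, sub_self]

/-- Projection theorem. -/
lemma exists_projSet_eq_singleton [CompleteSpace H] (hpos : ∀ u : H, inner ℝ u u = 0 → u = 0)
    {C : Set H} (hne : C.Nonempty) (hcl : IsClosed C) (hconv : Convex ℝ C) (w : H) :
    ∃ p, projSet C w = {p} := by
  let := normedOfDefinite hpos
  obtain ⟨p, hp, hmin⟩ := exists_norm_eq_iInf_of_complete_convex hne hcl.isComplete hconv w
  have hvar := (norm_eq_iInf_iff_real_inner_le_zero hconv hp).1 hmin
  -- With the variational inequality at `p`, this expansion gives both minimality and uniqueness: a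
  -- second minimizer has `‖v - p‖² ≤ 0`.
  have hex : ∀ v, ‖w - v‖ ^ 2 = ‖w - p‖ ^ 2 - 2 * inner ℝ (w - p) (v - p) + ‖v - p‖ ^ 2 := by
    intro v
    rw [← norm_sub_sq_real, sub_sub_sub_cancel_right]
  refine ⟨p, eq_singleton_iff_unique_mem.2 ⟨⟨hp, fun v hv => ?_⟩, fun v hv => ?_⟩⟩
  · refine le_of_sq_le_sq ?_ (norm_nonneg _)
    nlinarith [hex v, hvar v hv, sq_nonneg ‖v - p‖]
  · have h1 := pow_le_pow_left₀ (norm_nonneg _) (hv.2 p hp) 2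
    have h2 : ‖v - p‖ ^ 2 = 0 := le_antisymm (by linarith [hex v, hvar v hv.1]) (sq_nonneg _)
    rw [← sub_eq_zero]
    exact hpos _ (by rw [real_inner_self_eq_norm_sq, h2])

lemma projSet_univ (hpos : ∀ u : H, inner ℝ u u = 0 → u = 0) (w : H) :
    projSet univ w = {w} := by
  refine eq_singleton_iff_unique_mem.2 ⟨⟨mem_univ _, fun v _ => by simp⟩, fun v hv => ?_⟩
  have h1 := hv.2 w (mem_univ _)
  rw [sub_self, norm_zero] at h1
  rw [eq_comm, ← sub_eq_zero]
  exact hpos _ (by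
    rw [real_inner_self_eq_norm_sq, le_antisymm h1 (norm_nonneg _), zero_pow two_ne_zero])

section

variable {C : Set H} {q : H} {φ : H → EReal}

/-- On `C` the subgradient inequality reads `⟨v - u, w - (u - q)⟩ ≤ ½‖v - u‖²`. Replacing `v` by `u
+ t(v - u)`, dividing by `t` and letting `t → 0` removes the quadratic term; the converse is
immediate because that term is nonnegative. Nonemptiness of `C` excludes subgradients at points
outside `C`. -/
lemma subdifferential_eq (hne : C.Nonempty) (hconv : Convex ℝ C)
    (hφ : ∀ u, φ u = indic C u + ((1 / 2 * ‖u‖ ^ 2 - inner ℝ q u : ℝ) : EReal)) (u : H) :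
    subdifferential φ u = normalCone C u + {u - q} := by
  have hex : ∀ v w : H, 1 / 2 * ‖v‖ ^ 2 - inner ℝ q v -
      (1 / 2 * ‖u‖ ^ 2 - inner ℝ q u + inner ℝ (v - u) w) =
      1 / 2 * ‖v - u‖ ^ 2 - inner ℝ (v - u) (w - (u - q)) := by
    intro v w
    rw [norm_sub_sq_real]
    simp only [inner_sub_left, inner_sub_right, real_inner_self_eq_norm_sq,
      real_inner_comm u v, real_inner_comm u q, real_inner_comm v q]
    ring
  ext w
  rw [add_singleton, mem_image]
  have hmem : (∃ x ∈ normalCone C u, x + (u - q) = w) ↔ w - (u - q) ∈ normalCone C u := by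
    constructor
    · rintro ⟨x, hx, rfl⟩
      rwa [add_sub_cancel_right]
    · exact fun h => ⟨_, h, sub_add_cancel _ _⟩
  rw [hmem]
  constructor
  · intro hw
    have huC : u ∈ C := by
      by_contra hu
      obtain ⟨v, hv⟩ := hne
      have := hw v
      rw [hφ u, hφ v, indic_add_of_notMem hu, indic_add_of_mem hv, EReal.top_add_coe] at this
      exact (EReal.coe_lt_top _).not_ge this
    have hw' : ∀ v ∈ C, inner ℝ (v - u) (w - (u - q)) ≤ 1 / 2 * ‖v - u‖ ^ 2 := by
      intro v hv
      have := hw v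
      rw [hφ u, hφ v, indic_add_of_mem huC, indic_add_of_mem hv, ← EReal.coe_add,
        EReal.coe_le_coe_iff] at this
      linarith [hex v w]
    refine ⟨huC, fun v hv => ?_⟩
    have hlim : Tendsto (fun t : ℝ => t * (1 / 2 * ‖v - u‖ ^ 2)) (𝓝[>] 0) (𝓝 0) := by
      have : Continuous fun t : ℝ => t * (1 / 2 * ‖v - u‖ ^ 2) := by fun_prop
      simpa using (this.tendsto 0).mono_left nhdsWithin_le_nhds
    refine ge_of_tendsto hlim ?_
    filter_upwards [Ioo_mem_nhdsGT (zero_lt_one (α := ℝ))] with t ht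
    have hz := hw' (u + t • (v - u)) (hconv.add_smul_sub_mem huC hv ⟨ht.1.le, ht.2.le⟩)
    rw [add_sub_cancel_left, real_inner_smul_left, norm_smul, Real.norm_of_nonneg ht.1.le,
      mul_pow] at hz
    have : t * inner ℝ (v - u) (w - (u - q)) ≤ t * (t * (1 / 2 * ‖v - u‖ ^ 2)) := by
      linarith
    exact le_of_mul_le_mul_left this ht.1
  · rintro ⟨huC, hw⟩ v
    rw [hφ u, hφ v, indic_add_of_mem huC]
    by_cases hv : v ∈ C
    · rw [indic_add_of_mem hv, ← EReal.coe_add, EReal.coe_le_coe_iff]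
      linarith [hex v w, hw v hv, sq_nonneg ‖v - u‖]
    · rw [indic_add_of_notMem hv]
      exact le_top

/-- Completing the square: on `C`, the proximal objective is `(1 + γ)/2 ‖w - v‖²` plus a constant
independent of `v`, and it is `⊤` elsewhere. -/
lemma proxSet_eq_projSet (hne : C.Nonempty)
    (hφ : ∀ u, φ u = indic C u + ((1 / 2 * ‖u‖ ^ 2 - inner ℝ q u : ℝ) : EReal))
    {γ : ℝ} (hγ : 0 < γ) (u : H) :
    proxSet (fun v => (γ : EReal) * φ v) u =
      projSet C ((1 / (1 + γ)) • u + (γ / (1 + γ)) • q) := by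
  set w := (1 / (1 + γ)) • u + (γ / (1 + γ)) • q with hw
  have hγ1 : 0 < 1 + γ := by linarith
  have hwu : ∀ v, (1 + γ) * inner ℝ w v = inner ℝ u v + γ * inner ℝ q v := by
    intro v
    rw [hw, inner_add_left, real_inner_smul_left, real_inner_smul_left]
    field_simp
  have hin : ∀ v ∈ C, (γ : EReal) * φ v + ((1 / 2 * ‖u - v‖ ^ 2 : ℝ) : EReal) =
      (((1 + γ) / 2 * ‖w - v‖ ^ 2 + (1 / 2 * ‖u‖ ^ 2 - (1 + γ) / 2 * ‖w‖ ^ 2) : ℝ) : EReal) := by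
    intro v hv
    rw [hφ, indic_add_of_mem hv, ← EReal.coe_mul, ← EReal.coe_add, EReal.coe_eq_coe_iff,
      norm_sub_sq_real, norm_sub_sq_real]
    linarith [hwu v]
  have hout : ∀ v, v ∉ C → (γ : EReal) * φ v + ((1 / 2 * ‖u - v‖ ^ 2 : ℝ) : EReal) = ⊤ := by
    intro v hv
    rw [hφ, indic_add_of_notMem hv, EReal.coe_mul_top_of_pos hγ, EReal.top_add_coe]
  have hle : ∀ p ∈ C, ∀ v ∈ C, (γ : EReal) * φ p + ((1 / 2 * ‖u - p‖ ^ 2 : ℝ) : EReal) ≤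
      (γ : EReal) * φ v + ((1 / 2 * ‖u - v‖ ^ 2 : ℝ) : EReal) ↔ ‖w - p‖ ≤ ‖w - v‖ := by
    intro p hp v hv
    rw [hin p hp, hin v hv, EReal.coe_le_coe_iff, add_le_add_iff_right,
      mul_le_mul_iff_right₀ (by positivity), sq_le_sq₀ (norm_nonneg _) (norm_nonneg _)]
  ext p
  constructor
  · intro hp
    have hpC : p ∈ C := by
      by_contra hpC
      obtain ⟨v, hv⟩ := hne
      have : (γ : EReal) * φ p + ((1 / 2 * ‖u - p‖ ^ 2 : ℝ) : EReal) ≤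
        (γ : EReal) * φ v + ((1 / 2 * ‖u - v‖ ^ 2 : ℝ) : EReal) := hp v
      rw [hout p hpC, hin v hv] at this
      exact (EReal.coe_lt_top _).not_ge this
    exact ⟨hpC, fun v hv => (hle p hpC v hv).1 (hp v)⟩
  · rintro ⟨hpC, hp⟩ v
    by_cases hv : v ∈ C
    · exact (hle p hpC v hv).2 (hp v hv)
    · exact le_of_le_of_eq le_top (hout v hv).symm

lemma hasGateauxGradientAt_quadratic (q u : H) :
    HasGateauxGradientAt (fun v : H => 1 / 2 * ‖v‖ ^ 2 - inner ℝ q v) (u - q) u := by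
  intro y
  have e : (fun t : ℝ => 1 / 2 * ‖u + t • y‖ ^ 2 - inner ℝ q (u + t • y)) = fun t : ℝ =>
      (1 / 2 * ‖u‖ ^ 2 - inner ℝ q u) + t * inner ℝ (u - q) y + t ^ 2 * (1 / 2 * ‖y‖ ^ 2) := by
    ext t
    rw [norm_add_sq_real, norm_smul, mul_pow, Real.norm_eq_abs, sq_abs, inner_add_right,
      inner_sub_left, real_inner_smul_right, real_inner_smul_right]
    ring
  rw [HasLineDerivAt, e]
  have h1 := ((hasDerivAt_id (0 : ℝ)).mul_const (inner ℝ (u - q) y)).const_add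
    (1 / 2 * ‖u‖ ^ 2 - inner ℝ q u)
  have h2 := ((hasDerivAt_id (0 : ℝ)).pow 2).mul_const (1 / 2 * ‖y‖ ^ 2)
  exact (h1.add h2).congr_deriv (by simp)

end

end HilbertConvex

/-! ### Lower bounds modulo finite rank, and transfer of completeness. -/

section FiniteDefect

variable {E X Z : Type*} [NormedAddCommGroup E] [NormedSpace ℝ E] [CompleteSpace E]
  [NormedAddCommGroup X] [NormedSpace ℝ X] [NormedAddCommGroup Z] [NormedSpace ℝ Z]
  [FiniteDimensional ℝ Z]

/-- An injective bounded linear operator that is bounded below up to a finite rank operator is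
bounded below. -/
lemma exists_norm_le_of_injective (T : E →L[ℝ] X) (K : E →L[ℝ] Z) {C : ℝ} (hC : 0 ≤ C)
    (h : ∀ p, ‖p‖ ≤ C * ‖(T p, K p)‖) (hinj : ∀ p, T p = 0 → p = 0) :
    ∃ M : ℝ, 0 ≤ M ∧ ∀ p, ‖p‖ ≤ M * ‖T p‖ := by
  -- Otherwise some unit vectors `p n` have `T (p n) → 0`. Along a subsequence `K (p n)` converges,
  -- its codomain being finite-dimensional. As `(T, K)` is a closed embedding, the subsequence
  -- itself converges, to a unit vector in the kernel of `T`.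
  by_contra! hcon
  have hseq : ∀ n : ℕ, ∃ p : E, ‖p‖ = 1 ∧ ‖T p‖ ≤ 1 / ((n : ℝ) + 1) := by
    intro n
    obtain ⟨p, hp⟩ := hcon ((n : ℝ) + 1) (by positivity)
    have hp0 : 0 < ‖p‖ := lt_of_le_of_lt (by positivity) hp
    refine ⟨‖p‖⁻¹ • p, by rw [norm_smul, norm_inv, norm_norm, inv_mul_cancel₀ hp0.ne'], ?_⟩
    rw [map_smul, norm_smul, norm_inv, norm_norm, inv_mul_eq_div, div_le_div_iff₀ hp0 (by positivity)]
    linarith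
  choose p hp1 hpT using hseq
  have hT : Tendsto (fun n => T (p n)) atTop (𝓝 0) :=
    squeeze_zero_norm hpT tendsto_one_div_add_atTop_nhds_zero_nat
  have := FiniteDimensional.proper ℝ Z
  obtain ⟨z, -, ψ, hψ, hz⟩ := tendsto_subseq_of_bounded
    (Metric.isBounded_closedBall (x := (0 : Z)) (r := ‖K‖)) (x := fun n => K (p n)) fun n => by
      rw [mem_closedBall_zero_iff]
      simpa [hp1 n] using K.le_opNorm (p n)
  have hanti : AntilipschitzWith C.toNNReal (T.prod K) :=
    (T.prod K).antilipschitz_of_bound fun p => by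
      rw [Real.coe_toNNReal C hC]
      exact h p
  have hemb := hanti.isClosedEmbedding (T.prod K).uniformContinuous
  have hlim : Tendsto (fun n => (T.prod K) (p (ψ n))) atTop (𝓝 (0, z)) :=
    (hT.comp hψ.tendsto_atTop).prodMk_nhds hz
  obtain ⟨v, hv⟩ := hemb.isClosed_range.mem_of_tendsto hlim
    (Eventually.of_forall fun n => mem_range_self _)
  rw [← hv] at hlim
  have hpv : Tendsto (fun n => p (ψ n)) atTop (𝓝 v) := hemb.tendsto_nhds_iff.2 hlim
  have hv0 : v = 0 := hinj v (congrArg Prod.fst hv)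
  have hn : Tendsto (fun n => ‖p (ψ n)‖) atTop (𝓝 ‖v‖) := hpv.norm
  simp only [hp1, hv0, norm_zero] at hn
  exact one_ne_zero (tendsto_nhds_unique tendsto_const_nhds hn)

/-- Version of `exists_norm_le_of_injective` on a closed subspace. -/
lemma exists_norm_le_of_injective_on (V : Submodule ℝ E) (hV : IsClosed (V : Set E))
    (T : E →L[ℝ] X) (K : E →L[ℝ] Z) {C : ℝ} (hC : 0 ≤ C)
    (h : ∀ p ∈ V, ‖p‖ ≤ C * ‖(T p, K p)‖) (hinj : ∀ p ∈ V, T p = 0 → p = 0) :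
    ∃ M : ℝ, 0 ≤ M ∧ ∀ p ∈ V, ‖p‖ ≤ M * ‖T p‖ := by
  have := hV.completeSpace_coe
  obtain ⟨M, hM, hb⟩ := exists_norm_le_of_injective (T ∘L V.subtypeL) (K ∘L V.subtypeL) hC
    (fun p => h p p.2) fun p hp => Subtype.ext (hinj p p.2 hp)
  exact ⟨M, hM, fun p hp => hb ⟨p, hp⟩⟩

end FiniteDefect

lemma completeSpace_of_isClosed_range {E F : Type*} [NormedAddCommGroup E] [NormedSpace ℝ E]
    [CompleteSpace E] [SeminormedAddCommGroup F] [NormedSpace ℝ F] (j : F →ₗ[ℝ] E)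
    (hj : IsClosed (range j)) {M : ℝ} (hM : ∀ u, ‖j u‖ ≤ M * ‖u‖) (hle : ∀ u, ‖u‖ ≤ ‖j u‖) :
    CompleteSpace F := by
  refine Metric.complete_of_cauchySeq_tendsto fun u hu => ?_
  obtain ⟨v, hv⟩ : ∃ v, Tendsto (fun n => j (u n)) atTop (𝓝 v) := cauchySeq_tendsto_of_complete
    (hu.map (j.mkContinuous M hM).uniformContinuous)
  obtain ⟨w, rfl⟩ := hj.mem_of_tendsto hv (Eventually.of_forall fun n => mem_range_self _)
  refine ⟨w, tendsto_iff_norm_sub_tendsto_zero.2 (squeeze_zero (fun n => norm_nonneg _)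
    (fun n => hle (u n - w)) ?_)⟩
  simpa using tendsto_iff_norm_sub_tendsto_zero.1 hv

/-! ### Closedness, the Poincaré inequality and completeness of `H¹_{0,Υ}(Ω)`. -/

section Completeness

variable {N : ℕ} {Ω Y : Set (Eu N)}

/-- For each fixed `θ` and `y`, both sides of the weak gradient identity are `L²` scalar products
with fixed functions, hence continuous in the pair. -/
lemma isClosed_H1 : IsClosed (H1 Ω : Set (WithLp 2 (L2 Ω × L2Vec Ω))) := by
  have e : (H1 Ω : Set (WithLp 2 (L2 Ω × L2Vec Ω))) =
      {p | ∀ θ : Eu N → ℝ, ContDiff ℝ ∞ θ → HasCompactSupport θ → tsupport θ ⊆ Ω → ∀ y : Eu N,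
        ∫ x in Ω, p.fst x * fderiv ℝ θ x y = - ∫ x in Ω, θ x * inner ℝ (p.snd x) y} := rfl
  rw [e]
  simp only [ofPred_forall]
  refine isClosed_iInter fun θ => isClosed_iInter fun h1 => isClosed_iInter fun h2 =>
    isClosed_iInter fun _ => isClosed_iInter fun y => ?_
  have m1 : MemLp (fun x => fderiv ℝ θ x y) 2 (volume.restrict Ω) :=
    (((h1.continuous_fderiv (by simp)).clm_apply continuous_const).memLp_of_hasCompactSupport
      (h2.fderiv_apply ℝ y)).restrict Ω
  have m2 : MemLp (fun x => θ x • y) 2 (volume.restrict Ω) :=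
    (ContinuousLinearMap.toSpanSingleton ℝ y).comp_memLp'
      ((h1.continuous.memLp_of_hasCompactSupport h2).restrict Ω)
  have e1 : ∀ p : WithLp 2 (L2 Ω × L2Vec Ω),
      ∫ x in Ω, p.fst x * fderiv ℝ θ x y = inner ℝ (m1.toLp _) p.fst := by
    intro p
    rw [L2.inner_def]
    apply integral_congr_ae
    filter_upwards [m1.coeFn_toLp] with x hx
    rw [hx]
    simp
  have e2 : ∀ p : WithLp 2 (L2 Ω × L2Vec Ω),
      ∫ x in Ω, θ x * inner ℝ (p.snd x) y = inner ℝ p.snd (m2.toLp _) := by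
    intro p
    rw [L2.inner_def]
    apply integral_congr_ae
    filter_upwards [m2.coeFn_toLp] with x hx
    rw [hx, real_inner_smul_right]
  simp only [e1, e2]
  have cf : Continuous fun p : WithLp 2 (L2 Ω × L2Vec Ω) => p.fst :=
    (WithLp.fstL 2 ℝ (L2 Ω) (L2Vec Ω)).continuous
  have cs : Continuous fun p : WithLp 2 (L2 Ω × L2Vec Ω) => p.snd :=
    (WithLp.sndL 2 ℝ (L2 Ω) (L2Vec Ω)).continuous
  exact isClosed_eq (continuous_const.inner cf) (cs.inner continuous_const).neg

/-- Continuity of `traceOp` gives `L²` convergence of the traces, and an a.e. convergent subsequence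
preserves their vanishing on `Y`. -/
lemma isClosed_H1Zero : IsClosed (H1Zero Ω Y : Set (H1 Ω)) := by
  refine IsSeqClosed.isClosed fun u v hu huv => ?_
  have ht : Tendsto (fun n => traceOp Ω (u n)) atTop (𝓝 (traceOp Ω v)) :=
    ((traceOp Ω).continuous.tendsto v).comp huv
  obtain ⟨ψ, -, hψ⟩ := (tendstoInMeasure_of_tendsto_Lp ht).exists_seq_tendsto_ae
  have hall : ∀ᵐ x ∂(μHE[N - 1] : Measure (Eu N)).restrict (frontier Ω),
      ∀ n, x ∈ Y → traceOp Ω (u n) x = 0 := ae_all_iff.2 hu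
  filter_upwards [hψ, hall] with x hx hz hY
  have : Tendsto (fun n => traceOp Ω (u (ψ n)) x) atTop (𝓝 0) := by
    simp only [hz _ hY, tendsto_const_nhds]
  exact tendsto_nhds_unique hx this

/-- `H¹_{0,Υ}(Ω)` as a space of pairs of a function and its gradient. -/
def h1ZeroPairs (Ω Y : Set (Eu N)) : Submodule ℝ (WithLp 2 (L2 Ω × L2Vec Ω)) :=
  (H1Zero Ω Y).map (H1 Ω).subtype

lemma isClosed_h1ZeroPairs :
    IsClosed (h1ZeroPairs Ω Y : Set (WithLp 2 (L2 Ω × L2Vec Ω))) :=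
  isClosed_H1.isClosedMap_subtype_val _ isClosed_H1Zero

lemma exists_norm_H1_le (hΩo : IsOpen Ω) (hb : Bornology.IsBounded Ω)
    (hLip : HasLipschitzBoundary Ω) : ∃ (F : Finset (L2 Ω)) (C : ℝ), 0 ≤ C ∧ ∀ p : H1 Ω,
      ‖p‖ ^ 2 ≤ C * (‖p.1.snd‖ ^ 2 + ∑ w ∈ F, (inner ℝ w p.1.fst) ^ 2) := by
  obtain ⟨F, C, hC, hF⟩ := isControlled_self hΩo hb hLip
  refine ⟨F, C + 1, by positivity, fun p => ?_⟩
  have hu := Lp.memLp p.1.fst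
  have hsq : ‖p.1.fst‖ ^ 2 = ∫ x in Ω, p.1.fst x ^ 2 := by
    rw [← real_inner_self_eq_norm_sq, L2.inner_def]
    apply integral_congr_ae
    filter_upwards with x
    rw [real_inner_self_eq_norm_sq, Real.norm_eq_abs, sq_abs]
  have hsum : 0 ≤ ∑ w ∈ F, (inner ℝ w p.1.fst) ^ 2 := Finset.sum_nonneg fun _ _ => sq_nonneg _
  have h1 := hF p
  rw [← ofReal_integral_eq_lintegral_ofReal hu.integrable_sq
    (Eventually.of_forall fun x => sq_nonneg _), ← hsq,
    ENNReal.ofReal_le_ofReal_iff (by positivity)] at h1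
  have h2 : ‖p‖ ^ 2 = ‖p.1.fst‖ ^ 2 + ‖p.1.snd‖ ^ 2 := WithLp.prod_norm_sq_eq_of_L2 p.1
  linarith

namespace H1ZeroSpace

lemma norm_eq (u : H1ZeroSpace Ω Y) : ‖u‖ = ‖u.grad‖ := rfl

lemma inner_eq (u v : H1ZeroSpace Ω Y) :
    inner ℝ u v = ∫ x in Ω, inner ℝ (grad u x) (grad v x) := rfl

/-- The pair `(u, Du)`. -/
def toPair : H1ZeroSpace Ω Y →ₗ[ℝ] WithLp 2 (L2 Ω × L2Vec Ω) where
  toFun u := u.toH1.1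
  map_add' _ _ := rfl
  map_smul' _ _ := rfl

lemma range_toPair : range (toPair (Ω := Ω) (Y := Y)) = h1ZeroPairs Ω Y := by
  ext p
  constructor
  · rintro ⟨u, rfl⟩
    exact ⟨u.toH1, u.2, rfl⟩
  · rintro ⟨u, hu, rfl⟩
    exact ⟨(⟨u, hu⟩ : H1Zero Ω Y), rfl⟩

lemma norm_toPair_sq (u : H1ZeroSpace Ω Y) : ‖u.toPair‖ ^ 2 = ‖u.fn‖ ^ 2 + ‖u‖ ^ 2 :=
  WithLp.prod_norm_sq_eq_of_L2 u.toH1.1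

lemma norm_le_norm_toPair (u : H1ZeroSpace Ω Y) : ‖u‖ ≤ ‖u.toPair‖ := by
  refine le_of_sq_le_sq ?_ (norm_nonneg _)
  linarith [norm_toPair_sq u, sq_nonneg ‖u.fn‖]

lemma norm_fn_le_norm_toPair (u : H1ZeroSpace Ω Y) : ‖u.fn‖ ≤ ‖u.toPair‖ := by
  refine le_of_sq_le_sq ?_ (norm_nonneg _)
  linarith [norm_toPair_sq u, sq_nonneg ‖u‖]

/-- Poincaré inequality: the `H¹` norm is controlled by the gradient norm. -/
lemma exists_norm_toPair_le (hΩo : IsOpen Ω) (hb : Bornology.IsBounded Ω)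
    (hLip : HasLipschitzBoundary Ω)
    (hpos : ∀ u : H1ZeroSpace Ω Y, inner ℝ u u = 0 → u = 0) :
    ∃ M : ℝ, 0 ≤ M ∧ ∀ u : H1ZeroSpace Ω Y, ‖u.toPair‖ ≤ M * ‖u‖ := by
  obtain ⟨F, C, hC, hF⟩ := exists_norm_H1_le hΩo hb hLip
  let T : WithLp 2 (L2 Ω × L2Vec Ω) →L[ℝ] L2Vec Ω := WithLp.sndL 2 ℝ (L2 Ω) (L2Vec Ω)
  let K : WithLp 2 (L2 Ω × L2Vec Ω) →L[ℝ] EuclideanSpace ℝ F :=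
    (EuclideanSpace.equiv F ℝ).symm.toContinuousLinearMap ∘L
      ContinuousLinearMap.pi fun w => innerSL ℝ (w : L2 Ω) ∘L WithLp.fstL 2 ℝ (L2 Ω) (L2Vec Ω)
  have hK : ∀ p, ‖K p‖ ^ 2 = ∑ w ∈ F, (inner ℝ w p.fst) ^ 2 := by
    intro p
    rw [EuclideanSpace.real_norm_sq_eq]
    exact Finset.sum_coe_sort F fun w => (inner ℝ w p.fst) ^ 2
  -- The factor `2` under the root arises because the product carries the maximum norm, while the
  -- control is by a sum of squares.
  have hbound : ∀ p ∈ h1ZeroPairs Ω Y, ‖p‖ ≤ √(2 * C) * ‖(T p, K p)‖ := by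
    rintro _ ⟨p, -, rfl⟩
    set P : WithLp 2 (L2 Ω × L2Vec Ω) := (H1 Ω).subtype p
    have h1 : ‖P‖ ^ 2 ≤ C * (‖T P‖ ^ 2 + ‖K P‖ ^ 2) := by
      rw [hK]
      exact hF p
    have h2 : ‖T P‖ ≤ ‖(T P, K P)‖ := norm_fst_le (T P, K P)
    have h3 : ‖K P‖ ≤ ‖(T P, K P)‖ := norm_snd_le (T P, K P)
    refine le_of_sq_le_sq ?_ (by positivity)
    rw [mul_pow, Real.sq_sqrt (by positivity)]
    calc ‖P‖ ^ 2 ≤ C * (‖T P‖ ^ 2 + ‖K P‖ ^ 2) := h1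
      _ ≤ C * (‖(T P, K P)‖ ^ 2 + ‖(T P, K P)‖ ^ 2) := by gcongr
      _ = 2 * C * ‖(T P, K P)‖ ^ 2 := by ring
  -- Definiteness of the scalar product enters here: it excludes nonzero elements with zero
  -- gradient.
  have hinj : ∀ p ∈ h1ZeroPairs Ω Y, T p = 0 → p = 0 := by
    intro p hp hTp
    rw [← SetLike.mem_coe, ← range_toPair] at hp
    obtain ⟨u, rfl⟩ := hp
    have hu : u.grad = 0 := hTp
    rw [hpos u (by
      rw [real_inner_self_eq_norm_sq, norm_eq, hu, norm_zero, zero_pow two_ne_zero]), map_zero]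
  obtain ⟨M, hM, h⟩ := exists_norm_le_of_injective_on _ isClosed_h1ZeroPairs T K
    (Real.sqrt_nonneg _) hbound hinj
  exact ⟨M, hM, fun u => h u.toPair ⟨u.toH1, u.2, rfl⟩⟩

/-- By the Poincaré inequality the gradient norm is equivalent to the `H¹` norm, for which the space
is closed in a complete one. -/
lemma completeSpace (hΩo : IsOpen Ω) (hb : Bornology.IsBounded Ω)
    (hLip : HasLipschitzBoundary Ω)
    (hpos : ∀ u : H1ZeroSpace Ω Y, inner ℝ u u = 0 → u = 0) :
    CompleteSpace (H1ZeroSpace Ω Y) := by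
  obtain ⟨M, -, h⟩ := exists_norm_toPair_le hΩo hb hLip hpos
  exact completeSpace_of_isClosed_range toPair (range_toPair ▸ isClosed_h1ZeroPairs) h
    norm_le_norm_toPair

/-- The functional `v ↦ ∫ f v` on `H¹_{0,Υ}(Ω)`. -/
lemma exists_functional (hΩo : IsOpen Ω) (hb : Bornology.IsBounded Ω)
    (hLip : HasLipschitzBoundary Ω)
    (hpos : ∀ u : H1ZeroSpace Ω Y, inner ℝ u u = 0 → u = 0) (f : L2 Ω) :
    ∃ ℓ : H1ZeroSpace Ω Y →L[ℝ] ℝ, ∀ v, ℓ v = ∫ x in Ω, f x * v.fn x := by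
  obtain ⟨M, -, h⟩ := exists_norm_toPair_le hΩo hb hLip hpos
  let L : H1ZeroSpace Ω Y →ₗ[ℝ] ℝ :=
    { toFun := fun u => inner ℝ f u.fn
      map_add' := fun u v => inner_add_right f u.fn v.fn
      map_smul' := fun c u => real_inner_smul_right f u.fn c }
  refine ⟨L.mkContinuous (‖f‖ * M) fun u => ?_, fun v => ?_⟩
  · refine (norm_inner_le_norm f u.fn).trans ?_
    rw [mul_assoc]
    refine mul_le_mul_of_nonneg_left ((norm_fn_le_norm_toPair u).trans (h u)) (norm_nonneg _)
  · change inner ℝ f v.fn = _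
    rw [L2.inner_def]
    apply integral_congr_ae
    filter_upwards with x
    simp [mul_comm]

end H1ZeroSpace

end Completeness

/-! ### The weak formulation with zero Neumann data. -/

namespace DomainDecomposition

variable {N m : ℕ} (D : DomainDecomposition N m)

lemma sub_isBounded (i : Fin m) : Bornology.IsBounded (D.sub i) :=
  D.isBounded.subset (D.sub_subset i)

/-- The interface integrals vanish for zero data, so a weak solution is exactly a Riesz
representative of `v ↦ ∫ f v`. -/
lemma isWeakSolution_zero_iff (i : Fin m) (f : L2 (D.sub i)) (u : D.H i) :
    D.IsWeakSolution i f 0 u ↔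
      ∀ v : D.H i, inner ℝ u v = ∫ x in D.sub i, f x * v.fn x := by
  have hz : ∀ (v : D.H i) (j : D.J i),
      ∫ x in D.Ups i j, (0 : D.G i) j x * traceOp (D.sub i) v.toH1 x
        ∂(μHE[N - 1] : Measure (Eu N)) = 0 := by
    intro v j
    apply integral_eq_zero_of_ae
    filter_upwards [Lp.coeFn_zero ℝ 2 ((μHE[N - 1] : Measure (Eu N)).restrict (D.Ups i j))]
      with x hx
    rw [PiLp.zero_apply, hx, Pi.zero_apply, zero_mul]
  simp only [IsWeakSolution, hz, mul_zero, Finset.sum_const_zero, add_zero,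
    H1ZeroSpace.inner_eq]

lemma integral_restr_mul (i : Fin m) (f : L2 D.Ω) (v : Eu N → ℝ) :
    ∫ x in D.sub i, D.restr i f x * v x = ∫ x in D.sub i, f x * v x := by
  apply integral_congr_ae
  filter_upwards [((Lp.memLp f).mono_measure
    (Measure.restrict_mono_set volume (D.sub_subset i))).coeFn_toLp] with x hx
  rw [restr, hx]

end DomainDecomposition

end DomDec

end

theorem proposition4p2 {N m : ℕ} (D : DomDec.DomainDecomposition N m)
    (hpos : ∀ (i : Fin m) (u : D.H i), inner ℝ u u = 0 → u = 0)
    (γ : ℝ) (hγ : 0 < γ) (f : DomDec.L2 D.Ω)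
    (C : ∀ i : Fin m, Set (D.H i))
    (hCne : ∀ i, (C i).Nonempty) (hCcl : ∀ i, IsClosed (C i)) (hCconv : ∀ i, Convex ℝ (C i))
    (φ : ∀ i : Fin m, D.H i → EReal)
    (hφ : ∀ (i : Fin m) (u : D.H i), φ i u = DomDec.indic (C i) u +
      ((1 / 2 * (∫ x in D.sub i, ‖u.grad x‖ ^ 2) - ∫ x in D.sub i, f x * u.fn x : ℝ) : EReal))
    (i : Fin m) :
    -- `H_i` is a Hilbert space, and `q = Q_i(f, 0, …, 0)` is well defined
    CompleteSpace (D.H i) ∧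
    (∃! q : D.H i, D.IsWeakSolution i (D.restr i f) 0 q) ∧
    ∃ q : D.H i, q = D.Q i (D.restr i f, 0) ∧ D.IsWeakSolution i (D.restr i f) 0 q ∧
    -- (i)
    ((∀ u : D.H i, φ i u =
        DomDec.indic (C i) u + ((1 / 2 * ‖u‖ ^ 2 - inner ℝ q u : ℝ) : EReal)) ∧
      (∀ u : D.H i, DomDec.subdifferential (φ i) u = DomDec.normalCone (C i) u + {u - q}) ∧
      (∀ u : D.H i, ∃ p : D.H i,
        DomDec.proxSet (fun v => (γ : EReal) * φ i v) u = {p} ∧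
        DomDec.projSet (C i) ((1 / (1 + γ)) • u + (γ / (1 + γ)) • q) = {p})) ∧
    -- (ii)
    (C i = Set.univ →
      (∀ u : D.H i, φ i u = ((1 / 2 * ‖u‖ ^ 2 - inner ℝ q u : ℝ) : EReal)) ∧
      (∀ u : D.H i, DomDec.HasGateauxGradientAt (fun v => (φ i v).toReal) (u - q) u) ∧
      (∀ u : D.H i, DomDec.proxSet (fun v => (γ : EReal) * φ i v) u =
        {(1 / (1 + γ)) • u + (γ / (1 + γ)) • q})) := by
  have hcomp : CompleteSpace (D.H i) :=
    DomDec.H1ZeroSpace.completeSpace (D.sub_isOpen i) (D.sub_isBounded i) (D.sub_lipschitz i)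
      (hpos i)
  obtain ⟨ℓ, hℓ⟩ := DomDec.H1ZeroSpace.exists_functional (D.sub_isOpen i) (D.sub_isBounded i)
    (D.sub_lipschitz i) (hpos i) (D.restr i f)
  obtain ⟨q, hq⟩ := DomDec.exists_inner_eq (hpos i) ℓ
  have hqw : D.IsWeakSolution i (D.restr i f) 0 q :=
    (D.isWeakSolution_zero_iff i _ q).2 fun v => by rw [hq, hℓ]
  have huniq : ∀ p, D.IsWeakSolution i (D.restr i f) 0 p → p = q := fun p hp =>
    DomDec.eq_of_forall_inner_eq (hpos i) fun v => by
      rw [(D.isWeakSolution_zero_iff i _ p).1 hp v, (D.isWeakSolution_zero_iff i _ q).1 hqw v]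
  -- `Q` is defined by choice, so existence is what makes it a weak solution; uniqueness then
  -- identifies it with `q`.
  have hQ : D.IsWeakSolution i (D.restr i f) 0 (D.Q i (D.restr i f, 0)) :=
    Classical.epsilon_spec (p := D.IsWeakSolution i (D.restr i f) 0) ⟨q, hqw⟩
  have hφ' : ∀ u, φ i u =
      DomDec.indic (C i) u + ((1 / 2 * ‖u‖ ^ 2 - inner ℝ q u : ℝ) : EReal) := by
    intro u
    have h1 : ∫ x in D.sub i, ‖u.grad x‖ ^ 2 = ‖u‖ ^ 2 := by
      rw [← real_inner_self_eq_norm_sq, DomDec.H1ZeroSpace.inner_eq]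
      simp only [real_inner_self_eq_norm_sq]
    rw [hφ i u, h1, hq, hℓ, D.integral_restr_mul]
  refine ⟨hcomp, ⟨q, hqw, huniq⟩, q, (huniq _ hQ).symm, hqw, ⟨hφ', ?_, ?_⟩, ?_⟩
  · exact DomDec.subdifferential_eq (hCne i) (hCconv i) hφ'
  · intro u
    rw [DomDec.proxSet_eq_projSet (hCne i) hφ' hγ]
    obtain ⟨p, hp⟩ := DomDec.exists_projSet_eq_singleton (hpos i) (hCne i) (hCcl i) (hCconv i)
      ((1 / (1 + γ)) • u + (γ / (1 + γ)) • q)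
    exact ⟨p, hp, hp⟩
  · intro hC
    have hreal : ∀ u, φ i u = ((1 / 2 * ‖u‖ ^ 2 - inner ℝ q u : ℝ) : EReal) := fun u => by
      rw [hφ' u, DomDec.indic_add_of_mem (hC ▸ Set.mem_univ u)]
    refine ⟨hreal, fun u => ?_, fun u => ?_⟩
    · simp only [hreal, EReal.toReal_coe]
      exact DomDec.hasGateauxGradientAt_quadratic q u
    · rw [DomDec.proxSet_eq_projSet (hCne i) hφ' hγ, hC, DomDec.projSet_univ (hpos i)]
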